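/- Definitions. A chord diagram is a circle together with a finite set of chords whose endpoints are pairwise distinct. A circle graph is the intersection graph of a chord diagram: its vertices are the chords, and two distinct chords are adjacent if and only if they intersect. The independence complex $I(G)$ of a graph $G$ is the simplicial complex (identified with its geometric realization) whose simplices are the nonempty sets of pairwise non-adjacent vertices of $G$. A wedge of spheres is a wedge sum $\bigvee_{j} S^{d_j}$ with $d_j\ge 0$, in which all spheres are attached at one common base point; the empty wedge is a point. Statement. (1) For every $k\ge 0$ and $i=1,\dots,k$, let $X_i$ be an arbitrary finite wedge of spheres, of possibly different dimensions, and let $Y = X_1\sqcup\dots\sqcup X_k$ be the disjoint union. Then there is a circle graph $G_Y$ such that $I(G_Y)$ is homotopy equivalent to $Y$. (2) Consequently, the conjecture of Przytycki and Silvero that the independence complex of every circle graph has the homotopy type of a wedge of spheres fails if all spheres of a wedge have to be attached at one common base point: there is a circle graph $G$ with at least one vertex such that $I(G)$ is not homotopy equivalent to any wedge of spheres (with finitely or infinitely many spheres). -/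

import Mathlib

open scoped ContinuousMap

/-- A chord diagram with chords indexed by `V`: the chord `v` joins the points `src v` and `tgt v`
of the unit circle, and all these endpoints are pairwise distinct. -/
structure ChordDiagram (V : Type*) where
  src : V → Circle
  tgt : V → Circle
  injective_endpoints : Function.Injective (Sum.elim src tgt)

/-- The chord `v`, as a straight line segment in the closed unit disc of `ℂ`. -/
def ChordDiagram.chord {V : Type*} (C : ChordDiagram V) (v : V) : Set ℂ :=
  segment ℝ (C.src v : ℂ) (C.tgt v : ℂ)

/-- The intersection graph of a chord diagram: the vertices are the chords, and two different
chords are adjacent when they intersect. -/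
def ChordDiagram.intersectionGraph {V : Type*} (C : ChordDiagram V) : SimpleGraph V where
  Adj v w := v ≠ w ∧ (C.chord v ∩ C.chord w).Nonempty
  symm := ⟨fun _ _ h => ⟨h.1.symm, by rw [Set.inter_comm]; exact h.2⟩⟩
  loopless := ⟨fun _ h => h.1 rfl⟩

/-- A circle graph: the intersection graph of a finite chord diagram. -/
def SimpleGraph.IsCircleGraph {V : Type*} (G : SimpleGraph V) : Prop :=
  Finite V ∧ ∃ C : ChordDiagram V, C.intersectionGraph = G

/-- The independence complex of a graph: its simplices are the nonempty finite sets of pairwise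
non-adjacent vertices. -/
def SimpleGraph.independenceComplex {V : Type*} (G : SimpleGraph V) :
    AbstractSimplicialComplex V where
  faces := {s | s.Nonempty ∧ G.IsIndepSet (s : Set V)}
  isRelLowerSet_faces := fun _ hs =>
    ⟨hs.1, fun _ hts ht => ⟨ht, hs.2.mono (Finset.coe_subset.2 hts)⟩⟩
  singleton_mem := fun v => ⟨Finset.singleton_nonempty v, by simp [SimpleGraph.isIndepSet_iff]⟩

/-- The geometric realization of a simplicial complex on a finite vertex set `V`, in barycentric
coordinates: the points of the standard simplex on `V` whose support lies in a face. It carries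
the subspace topology of `V → ℝ`. -/
def AbstractSimplicialComplex.realization {V : Type*} [Fintype V]
    (K : AbstractSimplicialComplex V) : Set (V → ℝ) :=
  {x | x ∈ stdSimplex ℝ V ∧ ∃ s ∈ K.faces, ∀ v, v ∉ s → x v = 0}

/-- The wedge sum of a family of pointed spaces: the quotient of the disjoint union of the spaces
and one further point that identifies all the base points with that point. (The further point
makes no difference unless the family is empty; the empty wedge is a one-point space.) -/
def WedgeSum {ι : Type*} (X : ι → Type*) (p : ∀ i, X i) : Type _ :=
  Quot (fun a b : Unit ⊕ (Σ i, X i) => a = Sum.inl () ∧ ∃ i, b = Sum.inr ⟨i, p i⟩)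

instance WedgeSum.instTopologicalSpace {ι : Type*} (X : ι → Type*) (p : ∀ i, X i)
    [∀ i, TopologicalSpace (X i)] : TopologicalSpace (WedgeSum X p) :=
  inferInstanceAs (TopologicalSpace (Quot _))

/-- The unit sphere `S^n` in `ℝ^(n+1)`; in particular `S^0` consists of two points. -/
abbrev StdSphere (n : ℕ) : Type := Metric.sphere (0 : EuclideanSpace ℝ (Fin (n + 1))) 1

/-- The base point `(1, 0, …, 0)` of `S^n`. -/
noncomputable def StdSphere.base (n : ℕ) : StdSphere n :=
  ⟨EuclideanSpace.single 0 1, by simp⟩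

/-- The wedge of the spheres `S^(d i)`, all attached at one common base point. -/
abbrev SphereWedge {ι : Type} (d : ι → ℕ) : Type :=
  WedgeSum (fun i => StdSphere (d i)) (fun i => StdSphere.base (d i))

/-! Two graph operations carry the construction. In a join every vertex of one graph is adjacent to
every vertex of the other, so no independent set meets both and the independence complex is the
disjoint union of the two complexes (`realizationJoin`). Adding a disjoint edge suspends the
complex, with the ends of the edge as poles (`isSuspension_realization`). Permutation graphs are
closed under both operations, and they are circle graphs (`IsPermutationGraph.isCircleGraph`).

A finite wedge of spheres is reached by induction on a bound for the dimensions. Its `S^0` summands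
only contribute isolated points (`SphereWedge.homeomorphSum`); the remaining spheres form, up to
homotopy, the suspension of the wedge with all dimensions lowered by one
(`SphereWedge.suspensionEquiv`). As the suspension is unreduced, the segment over the base point has
to be collapsed. This is done by an explicit deformation `StdSphere.push` of each sphere. It moves
that segment by the same contraction `arcContraction` in every dimension, so the deformations glue
over the wedge (`IsSuspension.homotopyEquivWedge`).

For the counterexample take two disjoint circles. In a wedge of spheres everything outside the path
component of the base point consists of isolated points. An equivalence would therefore either send
a circle to a point, making the circle contractible, or put both circles into one path component. -/

open Topology unitInterval

/-! ### Permutation graphs are circle graphs -/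

/-- The rational parametrization of the unit circle. -/
noncomputable def Circle.ofSlope (t : ℝ) : Circle :=
  ⟨⟨(1 - t ^ 2) / (1 + t ^ 2), 2 * t / (1 + t ^ 2)⟩, by
    have h : 1 + t ^ 2 ≠ 0 := by positivity
    refine mem_sphere_zero_iff_norm.2 ?_
    rw [Complex.norm_def, Complex.normSq_mk, Real.sqrt_eq_one]
    field_simp
    ring⟩

lemma Circle.ofSlope_re (t : ℝ) : (Circle.ofSlope t : ℂ).re = (1 - t ^ 2) / (1 + t ^ 2) := rfl

lemma Circle.ofSlope_im (t : ℝ) : (Circle.ofSlope t : ℂ).im = 2 * t / (1 + t ^ 2) := rfl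

lemma Circle.ofSlope_injective : Function.Injective Circle.ofSlope := by
  intro s t h
  have hs : 1 + s ^ 2 ≠ 0 := by positivity
  have ht : 1 + t ^ 2 ≠ 0 := by positivity
  have hre : (1 - s ^ 2) / (1 + s ^ 2) = (1 - t ^ 2) / (1 + t ^ 2) := by
    rw [← ofSlope_re, ← ofSlope_re, h]
  have him : 2 * s / (1 + s ^ 2) = 2 * t / (1 + t ^ 2) := by
    rw [← ofSlope_im, ← ofSlope_im, h]
  rw [div_eq_div_iff hs ht] at hre him
  have h2 : s ^ 2 = t ^ 2 := by linarith
  rw [h2] at him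
  have := mul_right_cancel₀ ht him
  linarith

/-- Chords of the unit circle whose endpoints do not separate each other are disjoint. -/
lemma Circle.segment_ofSlope_disjoint {t₁ t₂ t₃ t₄ : ℝ}
    (h : 0 < ((t₁ - t₃) * (t₁ - t₄)) * ((t₂ - t₃) * (t₂ - t₄))) :
    ¬ (segment ℝ (ofSlope t₁ : ℂ) (ofSlope t₂) ∩
      segment ℝ (ofSlope t₃ : ℂ) (ofSlope t₄)).Nonempty := by
  rintro ⟨z, ⟨a, b, ha, hb, hab, hz⟩, ⟨c, d, -, -, hcd, hz'⟩⟩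
  -- `L = 0` is the line through the points of parameters `t₃` and `t₄`. The sign of `L` at
  -- parameter `t` is that of `-(t - t₃) * (t - t₄)`, so `h` puts `t₁` and `t₂` strictly on one
  -- side.
  let L : ℂ → ℝ := fun z => (1 - t₃ * t₄) * z.re + (t₃ + t₄) * z.im - (1 + t₃ * t₄)
  have hL : ∀ t, L (ofSlope t) = -2 * ((t - t₃) * (t - t₄)) / (1 + t ^ 2) := fun t => by
    have ht : 1 + t ^ 2 ≠ 0 := by positivity
    simp only [L, ofSlope_re, ofSlope_im]
    field_simp
    ring
  have hcomb : ∀ (p q : ℝ) (u v : ℂ), p + q = 1 → L (p • u + q • v) = p * L u + q * L v := by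
    intro p q u v hpq
    obtain rfl : q = 1 - p := by linarith
    simp [L]
    ring
  have h0 : L z = 0 := by rw [← hz', hcomb _ _ _ _ hcd, hL, hL]; simp
  rw [← hz, hcomb _ _ _ _ hab, hL, hL] at h0
  have h1 : 0 < 1 + t₁ ^ 2 := by positivity
  have h2 : 0 < 1 + t₂ ^ 2 := by positivity
  set x := (t₁ - t₃) * (t₁ - t₄)
  set y := (t₂ - t₃) * (t₂ - t₄)
  have key : a * x * (1 + t₂ ^ 2) + b * y * (1 + t₁ ^ 2) = 0 := by
    field_simp at h0
    linarith
  have hx : x ≠ 0 := fun hx => by simp [hx] at h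
  -- Multiplying by `x` makes both coefficients positive, since `x * y > 0`; hence `a = b = 0`,
  -- against `a + b = 1`.
  have e : a * (x ^ 2 * (1 + t₂ ^ 2)) + b * ((x * y) * (1 + t₁ ^ 2)) = 0 := by
    linear_combination x * key
  have hp : 0 < x ^ 2 * (1 + t₂ ^ 2) := by positivity
  have hq : 0 < (x * y) * (1 + t₁ ^ 2) := by positivity
  have ha0 : a = 0 := by nlinarith [mul_nonneg ha hp.le, mul_nonneg hb hq.le]
  have hb0 : b = 0 := by nlinarith [mul_nonneg ha hp.le, mul_nonneg hb hq.le]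
  linarith

/-- Chords of the unit circle whose endpoints separate each other intersect. -/
lemma Circle.segment_ofSlope_inter {t₁ t₂ t₃ t₄ : ℝ} (h₁₃ : t₁ < t₃) (h₃₂ : t₃ < t₂)
    (h₂₄ : t₂ < t₄) :
    (segment ℝ (ofSlope t₁ : ℂ) (ofSlope t₂) ∩
      segment ℝ (ofSlope t₃ : ℂ) (ofSlope t₄)).Nonempty := by
  have h1 : 0 < 1 + t₁ ^ 2 := by positivity
  have h2 : 0 < 1 + t₂ ^ 2 := by positivity
  have h3 : 0 < 1 + t₃ ^ 2 := by positivity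
  have h4 : 0 < 1 + t₄ ^ 2 := by positivity
  -- Barycentric weights of the crossing point: `A : B` and `C : D` come from evaluating the linear
  -- equation of one chord at the two ends of the other and clearing denominators.
  let A := (1 + t₁ ^ 2) * ((t₂ - t₃) * (t₄ - t₂))
  let B := (1 + t₂ ^ 2) * ((t₃ - t₁) * (t₄ - t₁))
  let C := (1 + t₃ ^ 2) * ((t₄ - t₁) * (t₄ - t₂))
  let D := (1 + t₄ ^ 2) * ((t₃ - t₁) * (t₂ - t₃))
  have hA : 0 < A := mul_pos h1 (mul_pos (by linarith) (by linarith))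
  have hB : 0 < B := mul_pos h2 (mul_pos (by linarith) (by linarith))
  have hC : 0 < C := mul_pos h3 (mul_pos (by linarith) (by linarith))
  have hD : 0 < D := mul_pos h4 (mul_pos (by linarith) (by linarith))
  have cross : ∀ f : ℝ → ℝ,
      (A * f t₁ + B * f t₂) * (C + D) = (C * f t₃ + D * f t₄) * (A + B) →
      A / (A + B) * f t₁ + B / (A + B) * f t₂ = C / (C + D) * f t₃ + D / (C + D) * f t₄ := by
    intro f hf
    field_simp
    linarith
  refine ⟨(A / (A + B)) • (ofSlope t₁ : ℂ) + (B / (A + B)) • (ofSlope t₂ : ℂ),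
    ⟨A / (A + B), B / (A + B), by positivity, by positivity, by field_simp, rfl⟩,
    ⟨C / (C + D), D / (C + D), by positivity, by positivity, by field_simp, ?_⟩⟩
  apply Complex.ext
  · simp only [Complex.add_re, Complex.real_smul, Complex.re_ofReal_mul, ofSlope_re]
    refine (cross (fun t => (1 - t ^ 2) / (1 + t ^ 2)) ?_).symm
    simp only [A, B, C, D]
    field_simp
    ring
  · simp only [Complex.add_im, Complex.real_smul, Complex.im_ofReal_mul, ofSlope_im]
    refine (cross (fun t => 2 * t / (1 + t ^ 2)) ?_).symm
    simp only [A, B, C, D]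
    field_simp
    ring

namespace SimpleGraph

variable {V W : Type*}

/-- A permutation graph: the vertices carry two linear orders, and two vertices are adjacent when
the orders disagree about them. -/
def IsPermutationGraph (G : SimpleGraph V) : Prop :=
  ∃ a b : V → ℝ, a.Injective ∧ b.Injective ∧ (∀ v, a v ∈ Set.Ioo 0 1) ∧ (∀ v, b v ∈ Set.Ioo 0 1) ∧
    ∀ v w, G.Adj v w ↔ (a v - a w) * (b v - b w) < 0

lemma IsPermutationGraph.isCircleGraph [Finite V] {G : SimpleGraph V} (h : G.IsPermutationGraph) :
    G.IsCircleGraph := by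
  obtain ⟨a, b, ha, hb, ha', hb', hG⟩ := h
  -- All parameters `- b v` are negative and all `a v` positive. So two chords cross exactly when `-
  -- b` and `a` order them alike, that is, when `a` and `b` disagree.
  refine ⟨inferInstance, ⟨fun v => Circle.ofSlope (- b v), fun v => Circle.ofSlope (a v), ?_⟩, ?_⟩
  · rintro (v | v) (w | w) h <;> have h := Circle.ofSlope_injective h
    · rw [hb (neg_injective h)]
    · linarith [(hb' v).1, (ha' w).1]
    · linarith [(hb' w).1, (ha' v).1]
    · rw [ha h]
  ext v w
  simp only [ChordDiagram.intersectionGraph, ChordDiagram.chord, hG]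
  have hneg : ∀ u u', - b u < a u' := fun u u' => by linarith [(hb' u).1, (ha' u').1]
  constructor
  · rintro ⟨hne, hi⟩
    by_contra hlt
    have hpos : 0 < (a v - a w) * (b v - b w) := lt_of_le_of_ne (not_lt.1 hlt)
      (mul_ne_zero (sub_ne_zero.2 (ha.ne hne)) (sub_ne_zero.2 (hb.ne hne))).symm
    refine Circle.segment_ofSlope_disjoint ?_ hi
    have := mul_pos hpos (mul_pos (sub_pos.2 (hneg v w)) (sub_pos.2 (hneg w v)))
    linarith
  · intro hlt
    refine ⟨by rintro rfl; simp at hlt, ?_⟩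
    rcases mul_neg_iff.1 hlt with ⟨h1, h2⟩ | ⟨h1, h2⟩
    · rw [Set.inter_comm]
      exact Circle.segment_ofSlope_inter (by linarith) (hneg _ _) (by linarith)
    · exact Circle.segment_ofSlope_inter (by linarith) (hneg _ _) (by linarith)

/-! ### Joins and disjoint unions of permutation graphs -/

/-- The join of two graphs. -/
def join (G : SimpleGraph V) (H : SimpleGraph W) : SimpleGraph (V ⊕ W) :=
  (Gᶜ ⊕g Hᶜ)ᶜ

@[simp] lemma join_adj_inl {G : SimpleGraph V} {H : SimpleGraph W} {v v' : V} :
    (G.join H).Adj (.inl v) (.inl v') ↔ G.Adj v v' := by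
  simp only [join, compl_adj, ne_eq, Sum.inl.injEq, sum_adj_inl]
  exact ⟨fun h => by tauto, fun h => ⟨h.ne, by tauto⟩⟩

@[simp] lemma join_adj_inr {G : SimpleGraph V} {H : SimpleGraph W} {v v' : W} :
    (G.join H).Adj (.inr v) (.inr v') ↔ H.Adj v v' := by
  simp only [join, compl_adj, ne_eq, Sum.inr.injEq, sum_adj_inr]
  exact ⟨fun h => by tauto, fun h => ⟨h.ne, by tauto⟩⟩

@[simp] lemma join_adj_inl_inr {G : SimpleGraph V} {H : SimpleGraph W} {v : V} {w : W} :
    (G.join H).Adj (.inl v) (.inr w) := by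
  simp [join, SimpleGraph.sum]

@[simp] lemma join_adj_inr_inl {G : SimpleGraph V} {H : SimpleGraph W} {v : V} {w : W} :
    (G.join H).Adj (.inr w) (.inl v) := by
  simp [join, SimpleGraph.sum]

lemma injective_sumElim_halves {a : V → ℝ} {c : W → ℝ} (ha : a.Injective) (hc : c.Injective)
    (ha' : ∀ v, a v ∈ Set.Ioo 0 1) (hc' : ∀ w, c w ∈ Set.Ioo 0 1) :
    (Sum.elim (fun v => a v / 2) (fun w => (c w + 1) / 2)).Injective := by
  rintro (v | v) (w | w) h <;> simp only [Sum.elim_inl, Sum.elim_inr] at h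
  · rw [ha (by linarith : a v = a w)]
  · linarith [(ha' v).2, (hc' w).1]
  · linarith [(ha' w).2, (hc' v).1]
  · rw [hc (by linarith : c v = c w)]

lemma injective_sumElim_halves' {a : V → ℝ} {c : W → ℝ} (ha : a.Injective) (hc : c.Injective)
    (ha' : ∀ v, a v ∈ Set.Ioo 0 1) (hc' : ∀ w, c w ∈ Set.Ioo 0 1) :
    (Sum.elim (fun v => (a v + 1) / 2) (fun w => c w / 2)).Injective := by
  rintro (v | v) (w | w) h <;> simp only [Sum.elim_inl, Sum.elim_inr] at h
  · rw [ha (by linarith : a v = a w)]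
  · linarith [(ha' v).1, (hc' w).2]
  · linarith [(ha' w).1, (hc' v).2]
  · rw [hc (by linarith : c v = c w)]

lemma half_mem_Ioo {x : ℝ} (h : x ∈ Set.Ioo (0 : ℝ) 1) : x / 2 ∈ Set.Ioo (0 : ℝ) 1 :=
  ⟨by linarith [h.1], by linarith [h.2]⟩

lemma add_one_half_mem_Ioo {x : ℝ} (h : x ∈ Set.Ioo (0 : ℝ) 1) :
    (x + 1) / 2 ∈ Set.Ioo (0 : ℝ) 1 :=
  ⟨by linarith [h.1], by linarith [h.2]⟩

/-- One order puts `G` below `H`, the other puts it above, so every mixed pair is inverted. Halving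
and shifting leave the order inside each graph unchanged. -/
lemma IsPermutationGraph.join {G : SimpleGraph V} {H : SimpleGraph W}
    (hG : G.IsPermutationGraph) (hH : H.IsPermutationGraph) : (G.join H).IsPermutationGraph := by
  obtain ⟨a, b, ha, hb, ha', hb', hab⟩ := hG
  obtain ⟨c, d, hc, hd, hc', hd', hcd⟩ := hH
  refine ⟨_, _, injective_sumElim_halves ha hc ha' hc', injective_sumElim_halves' hb hd hb' hd',
    ?_, ?_, ?_⟩
  · rintro (v | v)
    exacts [half_mem_Ioo (ha' v), add_one_half_mem_Ioo (hc' v)]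
  · rintro (v | v)
    exacts [add_one_half_mem_Ioo (hb' v), half_mem_Ioo (hd' v)]
  · rintro (v | v) (w | w) <;> simp only [Sum.elim_inl, Sum.elim_inr]
    · rw [join_adj_inl, hab]
      constructor <;> intro h <;> linarith
    · refine iff_of_true join_adj_inl_inr (mul_neg_of_neg_of_pos ?_ ?_)
      · linarith [(ha' v).2, (hc' w).1]
      · linarith [(hb' v).1, (hd' w).2]
    · refine iff_of_true join_adj_inr_inl (mul_neg_of_pos_of_neg ?_ ?_)
      · linarith [(ha' w).2, (hc' v).1]
      · linarith [(hb' w).1, (hd' v).2]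
    · rw [join_adj_inr, hcd]
      constructor <;> intro h <;> linarith

/-- Both orders put `G` below `H`, so no mixed pair is inverted. -/
lemma IsPermutationGraph.sum {G : SimpleGraph V} {H : SimpleGraph W}
    (hG : G.IsPermutationGraph) (hH : H.IsPermutationGraph) : (G ⊕g H).IsPermutationGraph := by
  obtain ⟨a, b, ha, hb, ha', hb', hab⟩ := hG
  obtain ⟨c, d, hc, hd, hc', hd', hcd⟩ := hH
  refine ⟨_, _, injective_sumElim_halves ha hc ha' hc', injective_sumElim_halves hb hd hb' hd',
    ?_, ?_, ?_⟩
  · rintro (v | v)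
    exacts [half_mem_Ioo (ha' v), add_one_half_mem_Ioo (hc' v)]
  · rintro (v | v)
    exacts [half_mem_Ioo (hb' v), add_one_half_mem_Ioo (hd' v)]
  · rintro (v | v) (w | w) <;> simp only [Sum.elim_inl, Sum.elim_inr]
    · rw [sum_adj_inl, hab]
      constructor <;> intro h <;> linarith
    · refine iff_of_false (by simp [SimpleGraph.sum]) (not_lt.2 (mul_pos_of_neg_of_neg ?_ ?_).le)
      · linarith [(ha' v).2, (hc' w).1]
      · linarith [(hb' v).2, (hd' w).1]
    · refine iff_of_false (by simp [SimpleGraph.sum]) (not_lt.2 (mul_pos ?_ ?_).le)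
      · linarith [(ha' w).2, (hc' v).1]
      · linarith [(hb' w).2, (hd' v).1]
    · rw [sum_adj_inr, hcd]
      constructor <;> intro h <;> linarith

lemma IsPermutationGraph.of_subsingleton [Subsingleton V] (G : SimpleGraph V) :
    G.IsPermutationGraph :=
  ⟨fun _ => 1 / 2, fun _ => 1 / 2, Function.injective_of_subsingleton _,
    Function.injective_of_subsingleton _, fun _ => by norm_num, fun _ => by norm_num,
    fun v w => by simp [Subsingleton.elim v w]⟩

lemma isPermutationGraph_top_bool : (⊤ : SimpleGraph Bool).IsPermutationGraph := by
  refine ⟨fun i => if i then 1 / 3 else 2 / 3, fun i => if i then 2 / 3 else 1 / 3, ?_, ?_, ?_, ?_, ?_⟩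
  · rintro (_ | _) (_ | _) <;> norm_num
  · rintro (_ | _) (_ | _) <;> norm_num
  · rintro (_ | _) <;> norm_num
  · rintro (_ | _) <;> norm_num
  · rintro (_ | _) (_ | _) <;> norm_num

end SimpleGraph

/-! ### Homotopies out of quotients, sums and wedges -/

/-- A continuous family of paths is a homotopy. -/
lemma ContinuousMap.Homotopic.of_paths {X Y : Type*} [TopologicalSpace X] [TopologicalSpace Y]
    {f g : C(X, Y)} {P : X → C(I, Y)} (hP : Continuous P) (h0 : ∀ x, P x 0 = f x)
    (h1 : ∀ x, P x 1 = g x) : f.Homotopic g :=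
  ⟨{ toFun := fun p => P p.2 p.1
     continuous_toFun := by fun_prop
     map_zero_left := h0
     map_one_left := h1 }⟩

/-- The homotopy, as a continuous family of paths. -/
lemma ContinuousMap.Homotopic.exists_paths {X Y : Type*} [TopologicalSpace X] [TopologicalSpace Y]
    {f g : C(X, Y)} (h : f.Homotopic g) :
    ∃ P : C(X, C(I, Y)), (∀ x, P x 0 = f x) ∧ ∀ x, P x 1 = g x := by
  obtain ⟨H⟩ := h
  exact ⟨(H.toContinuousMap.comp ContinuousMap.prodSwap).curry, H.map_zero_left, H.map_one_left⟩

/-- Homotopies descend along quotient maps. -/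
lemma Topology.IsQuotientMap.homotopic {X X' Y : Type*} [TopologicalSpace X]
    [TopologicalSpace X'] [TopologicalSpace Y] {q : X → X'} (hq : IsQuotientMap q) {f g : C(X', Y)}
    (H : C(X × I, Y)) (hH : ∀ x x' t, q x = q x' → H (x, t) = H (x', t))
    (h0 : ∀ x, H (x, 0) = f (q x)) (h1 : ∀ x, H (x, 1) = g (q x)) : f.Homotopic g := by
  -- Descending the curried map `X → C(I, Y)` only needs `q` to be a quotient map; nothing has to be
  -- shown about `q × id`.
  have hc : Function.FactorsThrough H.curry (⟨q, hq.continuous⟩ : C(X, X')) :=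
    fun x x' h => ContinuousMap.ext fun t => hH x x' t h
  have key : ∀ x, hq.lift H.curry hc (q x) = H.curry x :=
    ContinuousMap.congr_fun (hq.lift_comp H.curry hc)
  refine .of_paths (P := hq.lift H.curry hc) (map_continuous _) ?_ ?_
  · intro y
    obtain ⟨x, rfl⟩ := hq.surjective y
    rw [key]
    exact h0 x
  · intro y
    obtain ⟨x, rfl⟩ := hq.surjective y
    rw [key]
    exact h1 x

lemma ContinuousMap.Homotopic.sumMap_id {X Y : Type*} [TopologicalSpace X]
    [TopologicalSpace Y] {f : C(X, X)} {g : C(Y, Y)} (hf : f.Homotopic (.id X))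
    (hg : g.Homotopic (.id Y)) {k : C(X ⊕ Y, X ⊕ Y)} (hl : ∀ x, k (.inl x) = .inl (f x))
    (hr : ∀ y, k (.inr y) = .inr (g y)) : k.Homotopic (.id (X ⊕ Y)) := by
  obtain ⟨P, hP0, hP1⟩ := hf.exists_paths
  obtain ⟨Q, hQ0, hQ1⟩ := hg.exists_paths
  refine .of_paths (P := Sum.elim (fun x => (⟨Sum.inl, continuous_inl⟩ : C(X, X ⊕ Y)).comp (P x))
    (fun y => (⟨Sum.inr, continuous_inr⟩ : C(Y, X ⊕ Y)).comp (Q y))) ?_ ?_ ?_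
  · exact continuous_sum_dom.2 ⟨by simp only [Sum.elim_comp_inl]; fun_prop,
      by simp only [Sum.elim_comp_inr]; fun_prop⟩
  · rintro (x | y)
    · simp [hP0, hl]
    · simp [hQ0, hr]
  · rintro (x | y)
    · simp [hP1]
    · simp [hQ1]

/-- Homotopy equivalences can be added. -/
def ContinuousMap.HomotopyEquiv.sumCongr {X X' Y Y' : Type*} [TopologicalSpace X]
    [TopologicalSpace X'] [TopologicalSpace Y] [TopologicalSpace Y'] (e : X ≃ₕ X') (e' : Y ≃ₕ Y') :
    (X ⊕ Y) ≃ₕ (X' ⊕ Y') where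
  toFun := ⟨Sum.map e e', e.continuous.sumMap e'.continuous⟩
  invFun := ⟨Sum.map e.symm e'.symm, e.symm.continuous.sumMap e'.symm.continuous⟩
  left_inv := .sumMap_id e.left_inv e'.left_inv (fun _ => rfl) fun _ => rfl
  right_inv := .sumMap_id e.right_inv e'.right_inv (fun _ => rfl) fun _ => rfl

/-! ### Suspensions -/

/-- The map `q` exhibits `T` as the unreduced suspension of `X`. -/
structure IsSuspension {X T : Type*} [TopologicalSpace X] [TopologicalSpace T]
    (q : X × Set.Icc (-1 : ℝ) 1 → T) : Prop where
  isQuotientMap : IsQuotientMap q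
  eq_iff : ∀ x x' s s', q (x, s) = q (x', s') ↔ s = s' ∧ (x = x' ∨ |(s : ℝ)| = 1)

/-- The relation on `X × [-1, 1]` that collapses the two ends. -/
def suspensionSetoid (X : Type*) : Setoid (X × Set.Icc (-1 : ℝ) 1) where
  r a b := a.2 = b.2 ∧ (a.1 = b.1 ∨ |(a.2 : ℝ)| = 1)
  iseqv :=
    { refl := fun _ => ⟨rfl, .inl rfl⟩
      symm := fun ⟨h, h'⟩ => ⟨h.symm, h'.imp Eq.symm (h ▸ ·)⟩
      trans := by
        rintro ⟨x, s⟩ ⟨y, t⟩ ⟨z, u⟩ ⟨h, h'⟩ ⟨k, k'⟩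
        dsimp only at *
        subst h k
        refine ⟨rfl, ?_⟩
        rcases h' with rfl | h'
        · exact k'
        · exact .inr h' }

/-- The unreduced suspension of a nonempty space. -/
abbrev Suspension (X : Type*) : Type _ := Quotient (suspensionSetoid X)

lemma isSuspension_mk (X : Type*) [TopologicalSpace X] :
    IsSuspension (Quotient.mk (suspensionSetoid X)) where
  isQuotientMap := isQuotientMap_quotient_mk'
  eq_iff _ _ _ _ := Quotient.eq

namespace IsSuspension

variable {X Y T S : Type*} [TopologicalSpace X] [TopologicalSpace Y] [TopologicalSpace T]
  [TopologicalSpace S] {q : X × Set.Icc (-1 : ℝ) 1 → T} {r : Y × Set.Icc (-1 : ℝ) 1 → S}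

lemma factorsThrough (hq : IsSuspension q) {f : C(X × Set.Icc (-1 : ℝ) 1, Y)}
    (hf : ∀ x x' (s : Set.Icc (-1 : ℝ) 1), |(s : ℝ)| = 1 → f (x, s) = f (x', s)) :
    Function.FactorsThrough f (⟨q, hq.isQuotientMap.continuous⟩ : C(_, T)) := by
  rintro ⟨x, s⟩ ⟨x', s'⟩ h
  obtain ⟨rfl, rfl | h⟩ := (hq.eq_iff _ _ _ _).1 h
  · rfl
  · exact hf _ _ _ h

/-- A map out of a suspension. -/
noncomputable def lift (hq : IsSuspension q) (f : C(X × Set.Icc (-1 : ℝ) 1, Y))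
    (hf : ∀ x x' (s : Set.Icc (-1 : ℝ) 1), |(s : ℝ)| = 1 → f (x, s) = f (x', s)) : C(T, Y) :=
  hq.isQuotientMap.lift f (hq.factorsThrough hf)

lemma lift_apply (hq : IsSuspension q) (f : C(X × Set.Icc (-1 : ℝ) 1, Y)) (hf) (a) :
    hq.lift f hf (q a) = f a :=
  ContinuousMap.congr_fun (hq.isQuotientMap.lift_comp f (hq.factorsThrough hf)) a

lemma pole_eq (hq : IsSuspension q) (x x' : X) {s : Set.Icc (-1 : ℝ) 1} (hs : |(s : ℝ)| = 1) :
    q (x, s) = q (x', s) := (hq.eq_iff _ _ _ _).2 ⟨rfl, .inr hs⟩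

/-- Homotopies between maps out of a suspension. -/
lemma homotopic (hq : IsSuspension q) {f g : C(T, Y)}
    (H : C((X × Set.Icc (-1 : ℝ) 1) × I, Y))
    (hH : ∀ x x' (s : Set.Icc (-1 : ℝ) 1) t, |(s : ℝ)| = 1 → H ((x, s), t) = H ((x', s), t))
    (h0 : ∀ a, H (a, 0) = f (q a)) (h1 : ∀ a, H (a, 1) = g (q a)) : f.Homotopic g := by
  refine hq.isQuotientMap.homotopic H ?_ h0 h1
  rintro ⟨x, s⟩ ⟨x', s'⟩ t h
  obtain ⟨rfl, rfl | h⟩ := (hq.eq_iff _ _ _ _).1 h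
  · rfl
  · exact hH _ _ _ _ h

/-- The map of suspensions induced by a map. -/
noncomputable def map (hq : IsSuspension q) (hr : IsSuspension r) (f : C(X, Y)) : C(T, S) :=
  hq.lift ⟨fun a => r (f a.1, a.2), hr.isQuotientMap.continuous.comp (by fun_prop)⟩
    fun _ _ _ h => hr.pole_eq _ _ h

lemma map_apply (hq : IsSuspension q) (hr : IsSuspension r) (f : C(X, Y)) (a) :
    hq.map hr f (q a) = r (f a.1, a.2) := lift_apply ..

/-- The given homotopy is applied at each height; the poles stay fixed. -/
lemma map_comp_homotopic_id (hq : IsSuspension q) (hr : IsSuspension r) {f : C(X, Y)}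
    {g : C(Y, X)} (h : (g.comp f).Homotopic (.id X)) :
    ((hr.map hq g).comp (hq.map hr f)).Homotopic (.id T) := by
  obtain ⟨H⟩ := h
  refine hq.homotopic ⟨fun a => q (H (a.2, a.1.1), a.1.2), hq.isQuotientMap.continuous.comp
    (by fun_prop)⟩ (fun _ _ _ _ h => hq.pole_eq _ _ h) ?_ ?_
  · intro a
    simp [map_apply]
  · intro a
    simp

/-- Suspension preserves homotopy equivalences. -/
noncomputable def homotopyEquiv (hq : IsSuspension q) (hr : IsSuspension r) (e : X ≃ₕ Y) :
    T ≃ₕ S where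
  toFun := hq.map hr e.toFun
  invFun := hr.map hq e.invFun
  left_inv := map_comp_homotopic_id hq hr e.left_inv
  right_inv := map_comp_homotopic_id hr hq e.right_inv

end IsSuspension

/-! ### Wedge sums -/

namespace WedgeSum

variable {ι : Type*} {X : ι → Type*} {p : ∀ i, X i}

variable (X p) in
/-- The base point of a wedge sum. -/
def base : WedgeSum X p := Quot.mk _ (.inl ())

variable (p) in
/-- The inclusion of a summand. -/
def incl (i : ι) (x : X i) : WedgeSum X p := Quot.mk _ (.inr ⟨i, x⟩)

@[simp] lemma incl_base (i : ι) : incl p i (p i) = base X p :=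
  (Quot.sound ⟨rfl, i, rfl⟩).symm

lemma base_or_incl (w : WedgeSum X p) : w = base X p ∨ ∃ i x, w = incl p i x := by
  obtain ⟨(⟨⟩ | ⟨i, x⟩), rfl⟩ := Quot.exists_rep w
  exacts [.inl rfl, .inr ⟨i, x, rfl⟩]

variable [∀ i, TopologicalSpace (X i)] {Y : Type*} [TopologicalSpace Y]

lemma isQuotientMap_mk : IsQuotientMap
    (Quot.mk _ : (Unit ⊕ Σ i, X i) → WedgeSum X p) := isQuotientMap_quot_mk

@[fun_prop] lemma continuous_incl (i : ι) : Continuous (incl p i) :=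
  isQuotientMap_mk.continuous.comp (continuous_inr.comp continuous_sigmaMk)

/-- A map out of a wedge sum. -/
def lift (b : Y) (f : ∀ i, C(X i, Y)) (hf : ∀ i, f i (p i) = b) : C(WedgeSum X p, Y) where
  toFun := Quot.lift (Sum.elim (fun _ => b) fun a => f a.1 a.2) <| by
    rintro _ _ ⟨rfl, i, rfl⟩
    exact (hf i).symm
  continuous_toFun := continuous_quot_lift _ <|
    continuous_const.sumElim (continuous_sigma fun i => (f i).continuous)

@[simp] lemma lift_base (b : Y) (f : ∀ i, C(X i, Y)) (hf : ∀ i, f i (p i) = b) :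
    lift b f hf (base X p) = b := rfl

@[simp] lemma lift_incl (b : Y) (f : ∀ i, C(X i, Y)) (hf : ∀ i, f i (p i) = b) (i : ι) (x : X i) :
    lift b f hf (incl p i x) = f i x := rfl

end WedgeSum

/-- A deformation of the suspension `Z` of `X` that shrinks the segment over `p` to its midpoint,
along the contraction `c` of `[-1, 1]`. -/
structure IsSegmentContraction {X Z : Type*} [TopologicalSpace X] [TopologicalSpace Z]
    (r : X × Set.Icc (-1 : ℝ) 1 → Z) (p : X) (c : C(I × Set.Icc (-1 : ℝ) 1, Set.Icc (-1 : ℝ) 1))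
    (h : C(I × Z, Z)) : Prop where
  zero : ∀ z, h (0, z) = z
  segment : ∀ t s, h (t, r (p, s)) = r (p, c (t, s))

namespace IsSuspension

variable {ι : Type*} {X Z : ι → Type*} [∀ i, TopologicalSpace (X i)] [∀ i, TopologicalSpace (Z i)]
  {T : Type*} [TopologicalSpace T] {p : ∀ i, X i} {b : ∀ i, Z i}
  {q : WedgeSum X p × Set.Icc (-1 : ℝ) 1 → T}
  {r : ∀ i, X i × Set.Icc (-1 : ℝ) 1 → Z i} {o : Set.Icc (-1 : ℝ) 1}
  {c : C(I × Set.Icc (-1 : ℝ) 1, Set.Icc (-1 : ℝ) 1)} {h : ∀ i, C(I × Z i, Z i)}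

/-- The map from the suspension of a wedge to the wedge of the suspensions. -/
noncomputable def toWedge (hq : IsSuspension q) (hr : ∀ i, IsSuspension (r i))
    (hb : ∀ i, b i = r i (p i, o)) (hc : ∀ s, c (1, s) = o)
    (hh : ∀ i, IsSegmentContraction (r i) (p i) c (h i)) : C(T, WedgeSum Z b) :=
  -- Each suspended summand is pushed to time `1`, when the segment over its base point has reached
  -- the base point. Currying the height makes this a map out of the wedge alone.
  hq.lift (ContinuousMap.uncurry (WedgeSum.lift (.const _ (WedgeSum.base Z b))
    (fun i => ContinuousMap.curry ⟨fun a => WedgeSum.incl b i (h i (1, r i a)),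
      by have := (hr i).isQuotientMap.continuous; fun_prop⟩)
    fun i => ContinuousMap.ext fun s => by simp [(hh i).segment, hc, ← hb])) <| by
  have key : ∀ (w : WedgeSum X p) (s : Set.Icc (-1 : ℝ) 1), |(s : ℝ)| = 1 →
      (WedgeSum.lift (.const _ (WedgeSum.base Z b))
    (fun i => ContinuousMap.curry ⟨fun a => WedgeSum.incl b i (h i (1, r i a)),
      by have := (hr i).isQuotientMap.continuous; fun_prop⟩)
    fun i => ContinuousMap.ext fun s => by simp [(hh i).segment, hc, ← hb]) w s =
      WedgeSum.base Z b := by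
    intro w s hs
    obtain rfl | ⟨i, x, rfl⟩ := w.base_or_incl
    · rfl
    · simp [(hr i).pole_eq x (p i) hs, (hh i).segment, hc, ← hb]
  intro w w' s hs
  exact (key w s hs).trans (key w' s hs).symm

lemma toWedge_incl (hq : IsSuspension q) (hr : ∀ i, IsSuspension (r i))
    (hb : ∀ i, b i = r i (p i, o)) (hc : ∀ s, c (1, s) = o)
    (hh : ∀ i, IsSegmentContraction (r i) (p i) c (h i)) (i : ι) (x : X i) (s) :
    hq.toWedge hr hb hc hh (q (WedgeSum.incl p i x, s)) =
      WedgeSum.incl b i (h i (1, r i (x, s))) := lift_apply ..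

lemma toWedge_base (hq : IsSuspension q) (hr : ∀ i, IsSuspension (r i))
    (hb : ∀ i, b i = r i (p i, o)) (hc : ∀ s, c (1, s) = o)
    (hh : ∀ i, IsSegmentContraction (r i) (p i) c (h i)) (s) :
    hq.toWedge hr hb hc hh (q (WedgeSum.base X p, s)) = WedgeSum.base Z b := lift_apply ..

/-- The map from the wedge of the suspensions to the suspension of a wedge. -/
noncomputable def ofWedge (hq : IsSuspension q) (hr : ∀ i, IsSuspension (r i))
    (hb : ∀ i, b i = r i (p i, o)) : C(WedgeSum Z b, T) :=
  WedgeSum.lift (q (WedgeSum.base X p, o))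
    (fun i => (hr i).map hq ⟨WedgeSum.incl p i, WedgeSum.continuous_incl i⟩)
    fun i => by simp [hb, map_apply]

lemma ofWedge_incl (hq : IsSuspension q) (hr : ∀ i, IsSuspension (r i))
    (hb : ∀ i, b i = r i (p i, o)) (i : ι) (a) :
    hq.ofWedge hr hb (WedgeSum.incl b i (r i a)) = q (WedgeSum.incl p i a.1, a.2) :=
  (hr i).map_apply hq _ a

lemma ofWedge_base (hq : IsSuspension q) (hr : ∀ i, IsSuspension (r i))
    (hb : ∀ i, b i = r i (p i, o)) :
    hq.ofWedge hr hb (WedgeSum.base Z b) = q (WedgeSum.base X p, o) := rfl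

/-- The suspension of a wedge is homotopy equivalent to the wedge of the suspensions. -/
noncomputable def homotopyEquivWedge (hq : IsSuspension q) (hr : ∀ i, IsSuspension (r i))
    (hb : ∀ i, b i = r i (p i, o)) (hc₀ : ∀ s, c (0, s) = s) (hc : ∀ s, c (1, s) = o)
    (hco : ∀ t, c (t, o) = o)
    (hh : ∀ i, IsSegmentContraction (r i) (p i) c (h i)) : T ≃ₕ WedgeSum Z b where
  toFun := hq.toWedge hr hb hc hh
  invFun := hq.ofWedge hr hb
  left_inv := by
    have hqc := hq.isQuotientMap.continuous
    have hrc := fun i => (hr i).isQuotientMap.continuous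
    -- `K` runs the deformations `h i` on the summands and `c` on the common base segment. They
    -- agree there because every `h i` induces the same `c`.
    let K : C(WedgeSum X p, C(Set.Icc (-1 : ℝ) 1 × I, T)) :=
      WedgeSum.lift ⟨fun a => q (WedgeSum.base X p, c (a.2, a.1)), by fun_prop⟩
        (fun i => ContinuousMap.curry ⟨fun a => hq.ofWedge hr hb
          (WedgeSum.incl b i (h i (a.2.2, r i (a.1, a.2.1)))), by have := hrc i; fun_prop⟩)
        fun i => ContinuousMap.ext fun a => by simp [(hh i).segment, ofWedge_incl]
    have hK : ∀ w (s : Set.Icc (-1 : ℝ) 1) t, |(s : ℝ)| = 1 → K w (s, t) = q (WedgeSum.base X p, c (t, s)) := by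
      intro w s t hs
      obtain rfl | ⟨i, x, rfl⟩ := w.base_or_incl
      · rfl
      · simp [K, (hr i).pole_eq x (p i) hs, (hh i).segment, ofWedge_incl]
    refine ContinuousMap.Homotopic.symm (hq.homotopic
      ⟨fun a => K a.1.1 (a.1.2, a.2), by fun_prop⟩ ?_ ?_ ?_)
    · intro w w' s t hs
      exact (hK w s t hs).trans (hK w' s t hs).symm
    · rintro ⟨w, s⟩
      obtain rfl | ⟨i, x, rfl⟩ := w.base_or_incl
      · simp [K, hc₀]
      · simp [K, (hh i).zero, ofWedge_incl]
    · rintro ⟨w, s⟩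
      obtain rfl | ⟨i, x, rfl⟩ := w.base_or_incl
      · simp [K, hc, toWedge_base, ofWedge_base]
      · simp [K, toWedge_incl]
  right_inv := by
    -- The `h i` themselves glue: `c` fixes `o`, so each `h i` fixes the base point `b i` at all
    -- times.
    refine ContinuousMap.Homotopic.symm (.of_paths (P := WedgeSum.lift (.const _ (WedgeSum.base Z b))
      (fun i => ContinuousMap.curry ⟨fun a => WedgeSum.incl b i (h i (a.2, a.1)), by fun_prop⟩)
      fun i => ContinuousMap.ext fun t => ?_) (map_continuous _) ?_ ?_)
    · simp [hb, (hh i).segment, hco]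
      rw [← hb, WedgeSum.incl_base]
    · intro w
      obtain rfl | ⟨i, z, rfl⟩ := w.base_or_incl
      · simp
      · simp [(hh i).zero]
    · intro w
      obtain rfl | ⟨i, z, rfl⟩ := w.base_or_incl
      · simp [ofWedge_base, toWedge_base]
      · obtain ⟨⟨x, s⟩, rfl⟩ := (hr i).isQuotientMap.surjective z
        simp [ofWedge_incl, toWedge_incl]

end IsSuspension

/-! ### Realizations of independence complexes -/

namespace SimpleGraph

variable {V W : Type} [Fintype V] [Fintype W] {G : SimpleGraph V} {H : SimpleGraph W}

/-- The support of a point is the smallest face that can contain it, and its independence is a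
product equation for each edge. This removes the choice of a face and gives closed conditions. -/
lemma mem_realization {x : V → ℝ} : x ∈ G.independenceComplex.realization ↔
    x ∈ stdSimplex ℝ V ∧ ∀ v w, G.Adj v w → x v * x w = 0 := by
  classical
  refine and_congr_right fun hx => ⟨?_, fun h => ?_⟩
  · rintro ⟨s, ⟨-, hs⟩, hsx⟩ v w hvw
    by_contra h0
    obtain ⟨hv, hw⟩ := mul_ne_zero_iff.1 h0
    exact hs (by_contra fun h => hv (hsx v h)) (by_contra fun h => hw (hsx w h)) hvw.ne hvw
  · refine ⟨Finset.univ.filter fun v => x v ≠ 0, ⟨?_, ?_⟩, by simp⟩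
    · rw [Finset.nonempty_iff_ne_empty]
      intro h0
      have h1 := hx.2
      rw [Finset.sum_eq_zero fun v _ => by_contra fun hv =>
        Finset.notMem_empty v (h0 ▸ Finset.mem_filter.2 ⟨Finset.mem_univ v, hv⟩)] at h1
      exact zero_ne_one h1
    · intro v hv w hw _ hvw
      simp only [Finset.coe_filter, Finset.mem_univ, true_and, Set.mem_ofPred_eq] at hv hw
      exact mul_ne_zero hv hw (h v w hvw)

/-- Compactness is what turns the continuous bijections and surjections below into homeomorphisms
and quotient maps. -/
lemma isCompact_realization : IsCompact G.independenceComplex.realization := by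
  have : G.independenceComplex.realization =
      stdSimplex ℝ V ∩ ⋂ v, ⋂ w, ⋂ _ : G.Adj v w, {x | x v * x w = 0} := by
    ext x
    simp [mem_realization]
  rw [this]
  refine (isCompact_stdSimplex ℝ V).inter_right ?_
  exact isClosed_iInter fun v => isClosed_iInter fun w => isClosed_iInter fun _ =>
    isClosed_eq (by fun_prop) (by fun_prop)

instance : CompactSpace G.independenceComplex.realization :=
  isCompact_iff_compactSpace.1 isCompact_realization

lemma continuous_coord (v : V) :
    Continuous fun x : G.independenceComplex.realization => x.1 v :=
  (continuous_apply v).comp continuous_subtype_val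

lemma sumElim_zero_mem_realization_join (x : G.independenceComplex.realization) :
    Sum.elim x.1 (0 : W → ℝ) ∈ (G.join H).independenceComplex.realization := by
  obtain ⟨⟨hx0, hx1⟩, hx⟩ := mem_realization.1 x.2
  refine mem_realization.2 ⟨⟨?_, by simpa using hx1⟩, ?_⟩
  · rintro (v | w)
    exacts [hx0 v, le_rfl]
  · rintro (v | v) (w | w) h
    · exact hx _ _ (join_adj_inl.1 h)
    all_goals simp

lemma zero_sumElim_mem_realization_join (x : H.independenceComplex.realization) :
    Sum.elim (0 : V → ℝ) x.1 ∈ (G.join H).independenceComplex.realization := by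
  obtain ⟨⟨hx0, hx1⟩, hx⟩ := mem_realization.1 x.2
  refine mem_realization.2 ⟨⟨?_, by simpa using hx1⟩, ?_⟩
  · rintro (v | w)
    exacts [le_rfl, hx0 w]
  · rintro (v | v) (w | w) h
    · simp
    · simp
    · simp
    · exact hx _ _ (join_adj_inr.1 h)

variable (G H) in
/-- The inclusion of the two independence complexes in that of the join. -/
def joinMap : G.independenceComplex.realization ⊕ H.independenceComplex.realization →
    (G.join H).independenceComplex.realization :=
  Sum.elim (fun x => ⟨_, sumElim_zero_mem_realization_join x⟩)
    fun x => ⟨_, zero_sumElim_mem_realization_join x⟩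

lemma continuous_joinMap : Continuous (joinMap G H) := by
  refine continuous_sum_dom.2 ⟨Continuous.subtype_mk (continuous_pi ?_) _,
    Continuous.subtype_mk (continuous_pi ?_) _⟩
  all_goals
    rintro (v | w)
    all_goals first | exact continuous_const | exact continuous_coord _

lemma exists_ne_zero_of_mem_realization (x : G.independenceComplex.realization) :
    ∃ v, x.1 v ≠ 0 := by
  by_contra! h
  simpa [h] using (mem_realization.1 x.2).1.2

lemma joinMap_injective : Function.Injective (joinMap G H) := by
  rintro (x | x) (y | y) h
  · rw [show x = y from Subtype.ext (funext fun v => congrFun (congrArg Subtype.val h) (.inl v))]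
  · obtain ⟨v, hv⟩ := exists_ne_zero_of_mem_realization x
    exact absurd (congrFun (congrArg Subtype.val h) (.inl v)) hv
  · obtain ⟨v, hv⟩ := exists_ne_zero_of_mem_realization y
    exact absurd (congrFun (congrArg Subtype.val h) (.inl v)).symm hv
  · rw [show x = y from Subtype.ext (funext fun v => congrFun (congrArg Subtype.val h) (.inr v))]

/-- One nonzero coordinate in `V` kills all coordinates in `W`, since every mixed pair is adjacent.
-/
lemma joinMap_surjective : Function.Surjective (joinMap G H) := by
  rintro ⟨z, hz⟩
  obtain ⟨⟨hz0, hz1⟩, hz⟩ := mem_realization.1 hz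
  rw [Fintype.sum_sum_type] at hz1
  by_cases h : ∃ v, z (.inl v) ≠ 0
  · obtain ⟨v, hv⟩ := h
    have hW : ∀ w, z (.inr w) = 0 := fun w =>
      (mul_eq_zero.1 (hz _ _ (join_adj_inl_inr (v := v) (w := w)))).resolve_left hv
    refine ⟨.inl ⟨fun v => z (.inl v), mem_realization.2 ⟨⟨fun v => hz0 _, ?_⟩,
      fun v w h => hz _ _ (join_adj_inl.2 h)⟩⟩, Subtype.ext (funext ?_)⟩
    · simpa [hW] using hz1
    · rintro (v | w)
      exacts [rfl, (hW w).symm]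
  · push Not at h
    refine ⟨.inr ⟨fun v => z (.inr v), mem_realization.2 ⟨⟨fun v => hz0 _, ?_⟩,
      fun v w h => hz _ _ (join_adj_inr.2 h)⟩⟩, Subtype.ext (funext ?_)⟩
    · simpa [h] using hz1
    · rintro (v | w)
      exacts [(h v).symm, rfl]

variable (G H) in
/-- The independence complex of a join is the disjoint union of the independence complexes. -/
noncomputable def realizationJoin :
    (G.independenceComplex.realization ⊕ H.independenceComplex.realization) ≃ₜ
      (G.join H).independenceComplex.realization :=
  Continuous.homeoOfEquivCompactToT2
    (f := Equiv.ofBijective (joinMap G H) ⟨joinMap_injective, joinMap_surjective⟩)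
    continuous_joinMap

/-! ### Adding a disjoint edge -/

/-- The coordinates of a point of the suspension of an independence complex. -/
def suspPoint (x : V → ℝ) (s : ℝ) : V ⊕ Bool → ℝ :=
  -- Height `s` puts weight `|s|` on `true` or `false` according to its sign, never on both, and
  -- leaves `1 - |s|` for `x`.
  Sum.elim (fun v => (1 - |s|) * x v) fun i => if i then max s 0 else max (-s) 0

lemma suspPoint_mem (x : G.independenceComplex.realization) (s : Set.Icc (-1 : ℝ) 1) :
    suspPoint x.1 s ∈ (G ⊕g (⊤ : SimpleGraph Bool)).independenceComplex.realization := by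
  obtain ⟨⟨hx0, hx1⟩, hx⟩ := mem_realization.1 x.2
  have hs : |(s : ℝ)| ≤ 1 := abs_le.2 s.2
  refine mem_realization.2 ⟨⟨?_, ?_⟩, ?_⟩
  · rintro (v | (_ | _))
    · exact mul_nonneg (by linarith) (hx0 v)
    · simp [suspPoint]
    · simp [suspPoint]
  · simp only [suspPoint, Fintype.sum_sum_type, Sum.elim_inl, Sum.elim_inr, ← Finset.mul_sum, hx1,
      Fintype.sum_bool]
    rcases le_total 0 (s : ℝ) with h | h
    · simp [h, abs_of_nonneg h]
    · simp [h, abs_of_nonpos h]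
  · rintro (v | v) (w | w) h
    · have := hx _ _ (sum_adj_inl.1 h)
      simp only [suspPoint, Sum.elim_inl]
      linear_combination (1 - |(s : ℝ)|) ^ 2 * this
    · simp [SimpleGraph.sum] at h
    · simp [SimpleGraph.sum] at h
    · rcases le_total 0 (s : ℝ) with h' | h' <;> rcases v with _ | _ <;> rcases w with _ | _ <;>
        simp_all [suspPoint]

/-- The independence complex of the disjoint union of `G` with an edge is the suspension of that
of `G`. -/
lemma isSuspension_realization [Nonempty V] : IsSuspension
    (fun a => ⟨suspPoint a.1.1 a.2, suspPoint_mem a.1 a.2⟩ :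
      G.independenceComplex.realization × Set.Icc (-1 : ℝ) 1 →
      (G ⊕g (⊤ : SimpleGraph Bool)).independenceComplex.realization) where
  isQuotientMap := by
    classical
    refine .of_surjective_continuous ?_ (Continuous.subtype_mk (continuous_pi ?_) _)
    · rintro ⟨z, hz⟩
      obtain ⟨⟨hz0, hz1⟩, hz⟩ := mem_realization.1 hz
      have hb : z (.inr true) * z (.inr false) = 0 := hz _ _ (sum_adj_inr.2 (by simp))
      have h0 := hz0 (.inr true)
      have h1 := hz0 (.inr false)
      simp only [Fintype.sum_sum_type, Fintype.sum_bool] at hz1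
      have hsum : 0 ≤ ∑ v, z (.inl v) := Finset.sum_nonneg fun v _ => hz0 _
      -- One of the two weights vanishes because the ends of the edge are adjacent, so their
      -- difference recovers the height.
      let s : ℝ := z (.inr true) - z (.inr false)
      have hs : |s| = z (.inr true) + z (.inr false) := by
        rcases mul_eq_zero.1 hb with h | h
        · simp [s, h, abs_of_nonneg h1]
        · simp [s, h, abs_of_nonneg h0]
      have hst : max s 0 = z (.inr true) := by
        rcases mul_eq_zero.1 hb with h | h <;> simp [s, h, h0, h1]
      have hsf : max (-s) 0 = z (.inr false) := by
        rcases mul_eq_zero.1 hb with h | h <;> simp [s, h, h0, h1]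
      have hs1 : |s| ≤ 1 := by linarith
      by_cases hs' : |s| = 1
      · have hz' : ∀ v, z (.inl v) = 0 := fun v =>
          (Finset.sum_eq_zero_iff_of_nonneg fun v _ => hz0 _).1 (by linarith) v
            (Finset.mem_univ v)
        obtain ⟨v₀⟩ := ‹Nonempty V›
        -- At a pole any point of the base will do; `Nonempty V` supplies a vertex.
        refine ⟨(⟨Pi.single v₀ 1, mem_realization.2 ⟨single_mem_stdSimplex ℝ v₀, ?_⟩⟩,
          ⟨s, abs_le.1 hs1⟩), Subtype.ext (funext ?_)⟩
        · intro v w h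
          by_cases hv : v = v₀
          · subst hv
            simp [h.ne.symm]
          · simp [hv]
        · rintro (v | (_ | _))
          · simp [suspPoint, hs', hz']
          · simpa [suspPoint] using hsf
          · simpa [suspPoint] using hst
      · have hpos : 0 < 1 - |s| := sub_pos.2 (lt_of_le_of_ne hs1 hs')
        refine ⟨(⟨fun v => z (.inl v) / (1 - |s|), mem_realization.2 ⟨⟨fun v =>
          div_nonneg (hz0 _) hpos.le, ?_⟩, ?_⟩⟩, ⟨s, abs_le.1 hs1⟩), Subtype.ext (funext ?_)⟩
        · rw [← Finset.sum_div, div_eq_one_iff_eq hpos.ne']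
          linarith
        · intro v w h
          rw [div_mul_div_comm, hz _ _ (sum_adj_inl.2 h), zero_div]
        · rintro (v | (_ | _))
          · simp only [suspPoint, Sum.elim_inl]
            field_simp
          · simpa [suspPoint] using hsf
          · simpa [suspPoint] using hst
    · rintro (v | (_ | _)) <;> simp only [suspPoint, Sum.elim_inl, Sum.elim_inr]
      · have := (continuous_coord (G := G) v).comp (continuous_fst (Y := Set.Icc (-1 : ℝ) 1))
        exact Continuous.mul (by fun_prop) this
      · simp only [Bool.false_eq_true, if_false]
        fun_prop
      · simp only [if_true]
        fun_prop
  eq_iff x x' s s' := by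
    constructor
    · intro h
      have h := congrArg Subtype.val h
      have ht : max (s : ℝ) 0 = max (s' : ℝ) 0 := by
        simpa [suspPoint] using congrFun h (.inr true)
      have hf : max (-s : ℝ) 0 = max (-s' : ℝ) 0 := by
        simpa [suspPoint] using congrFun h (.inr false)
      have hss : s = s' := by
        apply Subtype.ext
        have := max_zero_sub_max_neg_zero_eq_self (s : ℝ)
        have := max_zero_sub_max_neg_zero_eq_self (s' : ℝ)
        linarith
      subst hss
      refine ⟨rfl, or_iff_not_imp_right.2 fun hs => Subtype.ext (funext fun v => ?_)⟩
      exact mul_left_cancel₀ (sub_ne_zero.2 (Ne.symm hs)) (congrFun h (.inl v))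
    · rintro ⟨rfl, rfl | hs⟩
      · rfl
      · apply Subtype.ext
        funext i
        rcases i with v | i
        · simp [suspPoint, hs]
        · rfl

end SimpleGraph

/-! ### The suspension of a sphere -/

namespace StdSphere

lemma mem_iff {n : ℕ} {x : EuclideanSpace ℝ (Fin (n + 1))} :
    x ∈ Metric.sphere (0 : EuclideanSpace ℝ (Fin (n + 1))) 1 ↔ ∑ i, x i ^ 2 = 1 := by
  rw [mem_sphere_zero_iff_norm, EuclideanSpace.norm_eq, Real.sqrt_eq_one]
  simp

lemma sum_sq {n : ℕ} (x : StdSphere n) : ∑ i, x.1 i ^ 2 = 1 := mem_iff.1 x.2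

@[ext] lemma ext {n : ℕ} {x y : StdSphere n} (h : ∀ i, x.1 i = y.1 i) : x = y :=
  Subtype.ext (PiLp.ext h)

@[fun_prop] lemma continuous_coord {n : ℕ} (i : Fin (n + 1)) :
    Continuous fun x : StdSphere n => x.1 i := by fun_prop

lemma continuous_mk {n : ℕ} {A : Type*} [TopologicalSpace A]
    {f : A → EuclideanSpace ℝ (Fin (n + 1))} (hf : ∀ a, f a ∈ Metric.sphere 0 1)
    (h : ∀ i, Continuous fun a => f a i) : Continuous fun a => (⟨f a, hf a⟩ : StdSphere n) :=
  Continuous.subtype_mk ((PiLp.continuous_toLp 2 _).comp (continuous_pi h)) _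

lemma base_apply_zero (n : ℕ) : (base n).1 0 = 1 := by simp [base]

lemma base_apply_succ {n : ℕ} {i : Fin (n + 1)} (hi : i ≠ 0) : (base n).1 i = 0 := by
  simp [base, hi]

/-- The coordinates of a point of the suspension of a sphere. -/
noncomputable def suspVec {n : ℕ} (y : StdSphere n) (s : ℝ) : EuclideanSpace ℝ (Fin (n + 2)) :=
  WithLp.toLp 2 (Fin.snoc (α := fun _ => ℝ) (fun i => √(1 - s ^ 2) * y.1 i) s)

lemma suspVec_castSucc {n : ℕ} (y : StdSphere n) (s : ℝ) (i : Fin (n + 1)) :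
    suspVec y s i.castSucc = √(1 - s ^ 2) * y.1 i := by simp [suspVec]

lemma suspVec_last {n : ℕ} (y : StdSphere n) (s : ℝ) :
    suspVec y s (Fin.last _) = s := by simp [suspVec]

lemma one_sub_sq_nonneg {s : ℝ} (hs : s ∈ Set.Icc (-1 : ℝ) 1) : 0 ≤ 1 - s ^ 2 := by
  nlinarith [hs.1, hs.2]

lemma suspVec_mem {n : ℕ} (y : StdSphere n) (s : Set.Icc (-1 : ℝ) 1) :
    suspVec y s ∈ Metric.sphere (0 : EuclideanSpace ℝ (Fin (n + 1 + 1))) 1 := by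
  rw [mem_iff, Fin.sum_univ_castSucc]
  simp only [suspVec_castSucc, suspVec_last, mul_pow, Real.sq_sqrt (one_sub_sq_nonneg s.2),
    ← Finset.mul_sum, sum_sq]
  ring

/-- The map from `S^n × [-1, 1]` to `S^(n+1)`. -/
noncomputable def susp (n : ℕ) (a : StdSphere n × Set.Icc (-1 : ℝ) 1) : StdSphere (n + 1) :=
  ⟨suspVec a.1 a.2, suspVec_mem a.1 a.2⟩

lemma continuous_susp (n : ℕ) : Continuous (susp n) := by
  refine continuous_mk (fun a : StdSphere n × Set.Icc (-1 : ℝ) 1 => suspVec_mem a.1 a.2) ?_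
  intro i
  refine Fin.lastCases ?_ (fun i => ?_) i
  · simp only [suspVec_last]
    fun_prop
  · simp only [suspVec_castSucc]
    fun_prop

lemma abs_eq_one_of_sqrt {s : ℝ} (hs : s ∈ Set.Icc (-1 : ℝ) 1) (h : √(1 - s ^ 2) = 0) :
    |s| = 1 := by
  rw [Real.sqrt_eq_zero (one_sub_sq_nonneg hs)] at h
  exact (sq_eq_sq₀ (abs_nonneg s) zero_le_one).1 (by rw [sq_abs]; linarith)

/-- The last coordinate is the height. Off the poles, normalizing the other coordinates recovers the
point of `S^n`; compactness gives the quotient topology. -/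
lemma isSuspension_susp (n : ℕ) : IsSuspension (susp n) where
  isQuotientMap := by
    refine .of_surjective_continuous ?_ (continuous_susp n)
    intro z
    have hz := sum_sq z
    rw [Fin.sum_univ_castSucc] at hz
    set s := z.1 (Fin.last _) with hsdef
    have hnn : 0 ≤ ∑ i : Fin (n + 1), z.1 i.castSucc ^ 2 := Finset.sum_nonneg fun _ _ => sq_nonneg _
    have hs : s ∈ Set.Icc (-1 : ℝ) 1 := abs_le.1 (abs_le_one_iff_mul_self_le_one.2 (by nlinarith))
    have hq : √(1 - s ^ 2) ^ 2 = 1 - s ^ 2 := Real.sq_sqrt (one_sub_sq_nonneg hs)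
    by_cases h0 : √(1 - s ^ 2) = 0
    · refine ⟨(base n, ⟨s, hs⟩), ext fun i => Fin.lastCases ?_ (fun i => ?_) i⟩
      · exact suspVec_last _ _
      · rw [h0] at hq
        have := (Finset.sum_eq_zero_iff_of_nonneg fun _ _ => sq_nonneg _).1
          (show ∑ i : Fin (n + 1), z.1 i.castSucc ^ 2 = 0 by linarith) i (Finset.mem_univ i)
        exact (suspVec_castSucc _ _ _).trans
          (by rw [h0, zero_mul, pow_eq_zero_iff two_ne_zero |>.1 this])
    · refine ⟨(⟨WithLp.toLp 2 fun i => z.1 i.castSucc / √(1 - s ^ 2), mem_iff.2 ?_⟩, ⟨s, hs⟩),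
        ext fun i => Fin.lastCases ?_ (fun i => ?_) i⟩
      · simp only [div_pow, ← Finset.sum_div]
        rw [div_eq_one_iff_eq (pow_ne_zero 2 h0), hq]
        linarith
      · exact suspVec_last _ _
      · refine (suspVec_castSucc _ _ _).trans ?_
        simp only
        field_simp
  eq_iff x x' s s' := by
    constructor
    · intro h
      have h : ∀ i, suspVec x s i = suspVec x' s' i := fun i => by
        have := congrArg Subtype.val h
        exact congrArg (fun f : EuclideanSpace ℝ (Fin (n + 2)) => f i) this
      have hs : s = s' := Subtype.ext (by simpa only [suspVec_last] using h (Fin.last _))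
      subst hs
      refine ⟨rfl, or_iff_not_imp_right.2 fun hs => ext fun i => ?_⟩
      have := h i.castSucc
      rw [suspVec_castSucc, suspVec_castSucc] at this
      exact mul_left_cancel₀ (fun h0 => hs (abs_eq_one_of_sqrt s.2 h0)) this
    · rintro ⟨rfl, rfl | hs⟩
      · rfl
      · refine ext fun i => Fin.lastCases ?_ (fun i => ?_) i
        · exact (suspVec_last _ _).trans (suspVec_last _ _).symm
        · refine (suspVec_castSucc _ _ _).trans (.trans ?_ (suspVec_castSucc _ _ _).symm)
          rw [← sq_abs, hs]
          simp

/-- The midpoint of `[-1, 1]`. -/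
def mid : Set.Icc (-1 : ℝ) 1 := ⟨0, by norm_num⟩

lemma base_eq_susp (n : ℕ) : base (n + 1) = susp n (base n, mid) := by
  refine ext fun i => Fin.lastCases ?_ (fun i => ?_) i
  · exact (base_apply_succ (Fin.last_pos.ne')).trans (suspVec_last _ _).symm
  · refine .trans ?_ (suspVec_castSucc _ _ _).symm
    by_cases hi : i = 0
    · subst hi
      rw [Fin.castSucc_zero, base_apply_zero, base_apply_zero]
      simp [mid]
    · rw [base_apply_succ hi, base_apply_succ (by simpa using hi)]
      simp

/-! The deformation of a sphere that shrinks the half great circle over the base point. -/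

/-- The first coordinate of the unnormalized contraction of the half circle. -/
noncomputable def arcFst (t s : ℝ) : ℝ := √(1 - s ^ 2) + t * s ^ 2

/-- The last coordinate of the unnormalized contraction of the half circle. -/
def arcSnd (t s : ℝ) : ℝ := s * (1 - t)

/-- The length of the unnormalized contraction of the half circle. -/
noncomputable def arcNorm (t s : ℝ) : ℝ := √(arcFst t s ^ 2 + arcSnd t s ^ 2)

lemma arcFst_nonneg (t : I) (s : ℝ) : 0 ≤ arcFst t s :=
  add_nonneg (Real.sqrt_nonneg _) (mul_nonneg t.2.1 (sq_nonneg _))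

/-- The term `t * s ^ 2` keeps the path away from the origin: a vanishing first coordinate forces
`|s| = 1` and `t = 0`, and then the second coordinate is `s ≠ 0`. -/
lemma arc_pos (t : I) (s : Set.Icc (-1 : ℝ) 1) : 0 < arcFst t s ^ 2 + arcSnd t s ^ 2 := by
  refine lt_of_le_of_ne (by positivity) fun h0 => ?_
  have h1 : arcFst t s = 0 := by nlinarith [sq_nonneg (arcFst t s), sq_nonneg (arcSnd t s)]
  have h2 : arcSnd t s = 0 := by nlinarith [sq_nonneg (arcFst t s), sq_nonneg (arcSnd t s)]
  have h3 := Real.sqrt_nonneg (1 - (s : ℝ) ^ 2)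
  have h4 : 0 ≤ (t : ℝ) * (s : ℝ) ^ 2 := mul_nonneg t.2.1 (sq_nonneg _)
  unfold arcFst at h1
  have h5 := abs_eq_one_of_sqrt s.2 (by linarith)
  have h6 : (s : ℝ) ^ 2 = 1 := by rw [← sq_abs, h5, one_pow]
  have h7 : (t : ℝ) * (s : ℝ) ^ 2 = 0 := by linarith
  rw [h6, mul_one] at h7
  rw [arcSnd, h7, sub_zero, mul_one] at h2
  simp [h2] at h6

lemma arcNorm_pos (t : I) (s : Set.Icc (-1 : ℝ) 1) : 0 < arcNorm t s :=
  Real.sqrt_pos.2 (arc_pos t s)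

lemma arcNorm_sq (t : I) (s : Set.Icc (-1 : ℝ) 1) :
    arcNorm t s ^ 2 = arcFst t s ^ 2 + arcSnd t s ^ 2 := Real.sq_sqrt (arc_pos t s).le

lemma arc_mem (t : I) (s : Set.Icc (-1 : ℝ) 1) : arcSnd t s / arcNorm t s ∈ Set.Icc (-1 : ℝ) 1 := by
  rw [Set.mem_Icc, ← abs_le, abs_div, abs_of_pos (arcNorm_pos t s), div_le_one (arcNorm_pos t s)]
  refine abs_le_of_sq_le_sq ?_ (arcNorm_pos t s).le
  rw [arcNorm_sq]
  nlinarith [sq_nonneg (arcFst t s)]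

lemma continuous_arcSnd : Continuous fun a : I × Set.Icc (-1 : ℝ) 1 => arcSnd a.1 a.2 := by
  unfold arcSnd
  fun_prop

lemma continuous_arcNorm : Continuous fun a : I × Set.Icc (-1 : ℝ) 1 => arcNorm a.1 a.2 := by
  unfold arcNorm arcSnd arcFst
  fun_prop

/-- The contraction of `[-1, 1]`. -/
noncomputable def arcContraction : C(I × Set.Icc (-1 : ℝ) 1, Set.Icc (-1 : ℝ) 1) where
  toFun a := ⟨arcSnd a.1 a.2 / arcNorm a.1 a.2, arc_mem a.1 a.2⟩
  continuous_toFun := by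
    exact Continuous.subtype_mk
      (continuous_arcSnd.div continuous_arcNorm fun a => (arcNorm_pos a.1 a.2).ne') _

lemma arcContraction_zero (s) : arcContraction (0, s) = s := by
  apply Subtype.ext
  have : 1 - (s : ℝ) ^ 2 + (s : ℝ) ^ 2 = 1 := by ring
  simp [arcContraction, arcSnd, arcNorm, arcFst, Real.sq_sqrt (one_sub_sq_nonneg s.2)]

lemma arcContraction_one (s) : arcContraction (1, s) = mid := by
  apply Subtype.ext
  simp [arcContraction, arcSnd, mid]

lemma arcContraction_mid (t) : arcContraction (t, mid) = mid := by
  apply Subtype.ext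
  simp [arcContraction, arcSnd, mid]

lemma sqrt_one_sub_arcContraction (t : I) (s : Set.Icc (-1 : ℝ) 1) :
    √(1 - (arcContraction (t, s) : ℝ) ^ 2) = arcFst t s / arcNorm t s := by
  have h := arcNorm_pos t s
  have e : 1 - (arcContraction (t, s) : ℝ) ^ 2 = (arcFst t s / arcNorm t s) ^ 2 := by
    simp only [arcContraction, ContinuousMap.coe_mk]
    field_simp
    linarith [arcNorm_sq t s]
  rw [e, Real.sqrt_sq (div_nonneg (arcFst_nonneg t s) h.le)]

/-- The unnormalized deformation of the sphere. -/
noncomputable def pushVec {n : ℕ} (t : ℝ) (z : StdSphere (n + 1)) :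
    EuclideanSpace ℝ (Fin (n + 2)) :=
  -- The last coordinate is drained into coordinate `0`. The cutoff is `1` when `z.1 0 ≥ 0`, in
  -- particular over the base point, where the arc formulas result; it is below `1` when `z.1 0 <
  -- 0`, where full draining could reach the origin.
  z.1 + (t * min 1 (1 + z.1 0)) • (EuclideanSpace.single 0 (z.1 (Fin.last _) ^ 2) -
    EuclideanSpace.single (Fin.last _) (z.1 (Fin.last _)))

lemma pushVec_zero {n : ℕ} (t : ℝ) (z : StdSphere (n + 1)) :
    pushVec t z 0 = z.1 0 + (t * min 1 (1 + z.1 0)) * z.1 (Fin.last _) ^ 2 := by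
  simp [pushVec, Fin.last_pos.ne]

lemma pushVec_last {n : ℕ} (t : ℝ) (z : StdSphere (n + 1)) :
    pushVec t z (Fin.last _) = z.1 (Fin.last _) * (1 - t * min 1 (1 + z.1 0)) := by
  simp [pushVec, Fin.last_pos.ne']
  ring

lemma pushVec_of_ne {n : ℕ} (t : ℝ) (z : StdSphere (n + 1)) {i : Fin (n + 2)} (h0 : i ≠ 0)
    (h1 : i ≠ Fin.last _) : pushVec t z i = z.1 i := by
  simp [pushVec, h0, h1]

lemma neg_one_le_coord {n : ℕ} (z : StdSphere n) (i) : -1 ≤ z.1 i := by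
  have h := Finset.single_le_sum (f := fun i => z.1 i ^ 2) (fun _ _ => sq_nonneg _)
    (Finset.mem_univ i)
  rw [sum_sq] at h
  exact (abs_le.1 (abs_le_one_iff_mul_self_le_one.2 (by nlinarith))).1

/-- If the last coordinate of `z` is zero, `z` does not move. Otherwise it is killed only when `t`
and the cutoff are both `1`; then `z.1 0 ≥ 0` and coordinate `0` becomes positive. -/
lemma pushVec_ne_zero {n : ℕ} (t : I) (z : StdSphere (n + 1)) : pushVec t z ≠ 0 := by
  intro h
  have hi : ∀ i, pushVec t z i = 0 := fun i => by rw [h]; rfl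
  have h0 := hi 0
  have hl := hi (Fin.last _)
  rw [pushVec_zero] at h0
  rw [pushVec_last] at hl
  have ht := t.2
  have hu : 0 ≤ min 1 (1 + z.1 0) := le_min zero_le_one (by linarith [neg_one_le_coord z 0])
  have hu' : min 1 (1 + z.1 0) ≤ 1 := min_le_left _ _
  by_cases hs : z.1 (Fin.last _) = 0
  · have hz : ∀ i, z.1 i = 0 := fun i => by
      by_cases h1 : i = Fin.last _
      · rw [h1, hs]
      by_cases h2 : i = 0
      · rw [h2]
        simpa [hs] using h0
      · rw [← pushVec_of_ne t z h2 h1, hi]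
    simpa [hz] using sum_sq z
  · have h1 : (t : ℝ) * min 1 (1 + z.1 0) = 1 := by
      have := (mul_eq_zero.1 hl).resolve_left hs
      linarith
    have h2 : 1 ≤ min 1 (1 + z.1 0) := by nlinarith [ht.1, ht.2]
    have h3 : 0 ≤ z.1 0 := by linarith [min_le_right 1 (1 + z.1 0)]
    rw [h1] at h0
    have : 0 < z.1 (Fin.last _) ^ 2 := by positivity
    linarith

/-- The deformation of the sphere. -/
noncomputable def push (n : ℕ) : C(I × StdSphere (n + 1), StdSphere (n + 1)) where
  toFun a := ⟨‖pushVec a.1 a.2‖⁻¹ • pushVec a.1 a.2, by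
    rw [mem_sphere_zero_iff_norm, norm_smul, norm_inv, norm_norm,
      inv_mul_cancel₀ (norm_ne_zero_iff.2 (pushVec_ne_zero _ _))]⟩
  continuous_toFun := by
    have h : Continuous fun a : I × StdSphere (n + 1) => pushVec (a.1 : ℝ) a.2 := by
      refine (PiLp.continuous_toLp 2 fun _ => ℝ).comp
        (continuous_pi (f := fun (a : I × StdSphere (n + 1)) i => pushVec (a.1 : ℝ) a.2 i) fun i => ?_)
      by_cases h1 : i = Fin.last _
      · simp only [h1, pushVec_last]
        fun_prop
      by_cases h0 : i = 0
      · simp only [h0, pushVec_zero]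
        fun_prop
      · simp only [pushVec_of_ne _ _ h0 h1]
        fun_prop
    exact Continuous.subtype_mk ((h.norm.inv₀ fun a =>
      norm_ne_zero_iff.2 (pushVec_ne_zero _ _)).smul h) _

lemma push_apply {n : ℕ} (t : I) (z : StdSphere (n + 1)) (i) :
    (push n (t, z)).1 i = ‖pushVec t z‖⁻¹ * pushVec t z i := rfl

lemma susp_base_zero (n : ℕ) (s : Set.Icc (-1 : ℝ) 1) :
    (susp n (base n, s)).1 0 = √(1 - (s : ℝ) ^ 2) := by
  rw [← Fin.castSucc_zero]
  exact (suspVec_castSucc _ _ _).trans (by rw [base_apply_zero, mul_one])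

lemma susp_last (n : ℕ) (y : StdSphere n) (s : Set.Icc (-1 : ℝ) 1) :
    (susp n (y, s)).1 (Fin.last _) = s := suspVec_last _ _

lemma min_one_susp_base (n : ℕ) (s : Set.Icc (-1 : ℝ) 1) :
    min 1 (1 + (susp n (base n, s)).1 0) = 1 := by
  rw [susp_base_zero]
  exact min_eq_left (by linarith [Real.sqrt_nonneg (1 - (s : ℝ) ^ 2)])

lemma pushVec_susp_base_last (n : ℕ) (t : I) (s : Set.Icc (-1 : ℝ) 1) :
    pushVec t (susp n (base n, s)) (Fin.last _) = arcSnd t s := by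
  rw [pushVec_last, min_one_susp_base, susp_last, mul_one, arcSnd]

lemma pushVec_susp_base_castSucc (n : ℕ) (t : I) (s : Set.Icc (-1 : ℝ) 1) (i : Fin (n + 1)) :
    pushVec t (susp n (base n, s)) i.castSucc = arcFst t s * (base n).1 i := by
  by_cases hi : i = 0
  · rw [hi, Fin.castSucc_zero, pushVec_zero, min_one_susp_base, susp_last, susp_base_zero,
      base_apply_zero, arcFst]
    ring
  · rw [pushVec_of_ne _ _ (by simpa using hi) (Fin.castSucc_lt_last i).ne, base_apply_succ hi]
    exact (suspVec_castSucc _ _ _).trans (by rw [base_apply_succ hi, mul_zero, mul_zero])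

lemma norm_pushVec_susp_base (n : ℕ) (t : I) (s : Set.Icc (-1 : ℝ) 1) :
    ‖pushVec t (susp n (base n, s))‖ = arcNorm t s := by
  rw [EuclideanSpace.norm_eq, Fin.sum_univ_castSucc, arcNorm]
  simp only [pushVec_susp_base_last, pushVec_susp_base_castSucc, Real.norm_eq_abs, sq_abs, mul_pow,
    ← Finset.mul_sum, sum_sq, mul_one]

lemma isSegmentContraction_push (n : ℕ) :
    IsSegmentContraction (susp n) (base n) arcContraction (push n) where
  zero z := by
    have h : pushVec ((0 : I) : ℝ) z = z.1 := by simp [pushVec]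
    have h1 : ‖z.1‖ = 1 := mem_sphere_zero_iff_norm.1 z.2
    refine ext fun i => ?_
    rw [push_apply, h, h1, inv_one, one_mul]
  segment t s := by
    refine ext fun i => ?_
    rw [push_apply, norm_pushVec_susp_base]
    refine Fin.lastCases ?_ (fun i => ?_) i
    · rw [pushVec_susp_base_last]
      refine .trans ?_ (suspVec_last _ _).symm
      simp [arcContraction, div_eq_inv_mul]
    · rw [pushVec_susp_base_castSucc]
      refine .trans ?_ (suspVec_castSucc _ _ _).symm
      rw [sqrt_one_sub_arcContraction]
      ring

end StdSphere

/-! ### Spaces realized by permutation graphs -/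

/-- The space has the homotopy type of the independence complex of a finite permutation graph. -/
def IsIndependenceComplexType (Y : Type) [TopologicalSpace Y] : Prop :=
  ∃ (V : Type) (_ : Fintype V) (G : SimpleGraph V), G.IsPermutationGraph ∧
    Nonempty (G.independenceComplex.realization ≃ₕ Y)

namespace IsIndependenceComplexType

variable {X Y : Type} [TopologicalSpace X] [TopologicalSpace Y]

lemma congr (hX : IsIndependenceComplexType X) (e : X ≃ₕ Y) : IsIndependenceComplexType Y := by
  obtain ⟨V, hV, G, hG, ⟨f⟩⟩ := hX
  exact ⟨V, hV, G, hG, ⟨f.trans e⟩⟩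

lemma of_isEmpty [IsEmpty Y] : IsIndependenceComplexType Y := by
  refine ⟨Empty, inferInstance, ⊥, .of_subsingleton _, ⟨?_⟩⟩
  have : IsEmpty (⊥ : SimpleGraph Empty).independenceComplex.realization :=
    ⟨fun x => (SimpleGraph.exists_ne_zero_of_mem_realization x).choose.elim⟩
  exact (Homeomorph.empty : _ ≃ₜ Y).toHomotopyEquiv

lemma of_unique [Unique Y] : IsIndependenceComplexType Y := by
  refine ⟨Unit, inferInstance, ⊥, .of_subsingleton _, ⟨?_⟩⟩
  let e : (⊥ : SimpleGraph Unit).independenceComplex.realization ≃ Y :=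
    { toFun := fun _ => default
      invFun := fun _ => ⟨fun _ => 1, SimpleGraph.mem_realization.2
        ⟨⟨fun _ => zero_le_one, by simp⟩, by simp⟩⟩
      left_inv := fun x => Subtype.ext (funext fun _ => by
        simpa using (SimpleGraph.mem_realization.1 x.2).1.2.symm)
      right_inv := fun _ => Subsingleton.elim _ _ }
  exact Homeomorph.toHomotopyEquiv
    ⟨e, continuous_const, continuous_const⟩

lemma sum (hX : IsIndependenceComplexType X) (hY : IsIndependenceComplexType Y) :
    IsIndependenceComplexType (X ⊕ Y) := by
  obtain ⟨V, hV, G, hG, ⟨e⟩⟩ := hX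
  obtain ⟨W, hW, H, hH, ⟨f⟩⟩ := hY
  exact ⟨V ⊕ W, inferInstance, G.join H, hG.join hH,
    ⟨(SimpleGraph.realizationJoin G H).symm.toHomotopyEquiv.trans (e.sumCongr f)⟩⟩

/-- Nonemptiness matters: the quotient `Suspension X` of an empty `X` is empty, but the independence
complex of an edge is `S^0`. -/
lemma suspension [Nonempty X] (hX : IsIndependenceComplexType X) :
    IsIndependenceComplexType (Suspension X) := by
  obtain ⟨V, hV, G, hG, ⟨e⟩⟩ := hX
  obtain ⟨x⟩ := ‹Nonempty X›
  obtain ⟨v, -⟩ := SimpleGraph.exists_ne_zero_of_mem_realization (e.symm x)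
  have : Nonempty V := ⟨v⟩
  exact ⟨V ⊕ Bool, inferInstance, G ⊕g ⊤, hG.sum SimpleGraph.isPermutationGraph_top_bool,
    ⟨SimpleGraph.isSuspension_realization.homotopyEquiv (isSuspension_mk X) e⟩⟩

end IsIndependenceComplexType

/-- Splitting off the first summand of a finite disjoint union. -/
def Homeomorph.sigmaFinSucc {k : ℕ} (Y : Fin (k + 1) → Type*) [∀ i, TopologicalSpace (Y i)] :
    (Y 0 ⊕ Σ i : Fin k, Y i.succ) ≃ₜ Σ i, Y i where
  toFun := Sum.elim (Sigma.mk 0) fun a => ⟨a.1.succ, a.2⟩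
  invFun a := Fin.cases (motive := fun i => Y i → Y 0 ⊕ Σ i : Fin k, Y i.succ) Sum.inl
    (fun i y => Sum.inr ⟨i, y⟩) a.1 a.2
  left_inv := by rintro (y | ⟨i, y⟩) <;> rfl
  right_inv := by
    rintro ⟨i, y⟩
    induction i using Fin.cases <;> rfl
  continuous_toFun := continuous_sigmaMk.sumElim (continuous_sigma fun i => continuous_sigmaMk)
  continuous_invFun := by
    refine continuous_sigma fun i => ?_
    induction i using Fin.cases with
    | zero => exact continuous_inl
    | succ i =>
      exact continuous_inr.comp
        (continuous_sigmaMk : Continuous (Sigma.mk (β := fun i : Fin k => Y i.succ) i))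

lemma IsIndependenceComplexType.sigma_fin {k : ℕ} {Y : Fin k → Type} [∀ i, TopologicalSpace (Y i)]
    (h : ∀ i, IsIndependenceComplexType (Y i)) : IsIndependenceComplexType (Σ i, Y i) := by
  induction k with
  | zero => exact .of_isEmpty
  | succ k ih =>
    exact ((h 0).sum (ih fun i => h i.succ)).congr (Homeomorph.sigmaFinSucc Y).toHomotopyEquiv

lemma IsIndependenceComplexType.sigma_unit (ι : Type) [Finite ι] :
    IsIndependenceComplexType (Σ _ : ι, Unit) := by
  obtain ⟨n, ⟨e⟩⟩ := Finite.exists_equiv_fin ι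
  refine (sigma_fin (k := n) (Y := fun _ => Unit) fun _ => of_unique).congr
    (Homeomorph.toHomotopyEquiv ⟨(Equiv.sigmaCongrLeft' (β := fun _ => Unit) e).symm, ?_, ?_⟩)
  · exact continuous_sigma fun i => continuous_of_discreteTopology
  · exact continuous_sigma fun i => continuous_of_discreteTopology

/-! ### Wedges of spheres -/

namespace StdSphere

lemma eq_base_or_neg (y : StdSphere 0) : y = base 0 ∨ y = -base 0 := by
  have h := sum_sq y
  rw [Fin.sum_univ_one] at h
  rw [sq, mul_self_eq_one_iff] at h
  refine h.imp (fun h => ext fun i => ?_) fun h => ext fun i => ?_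
  · rw [Fin.fin_one_eq_zero i, h, base_apply_zero]
  · change _ = -(base 0).1 i
    rw [Fin.fin_one_eq_zero i, h, base_apply_zero]

lemma discreteTopology {n : ℕ} (hn : n = 0) : DiscreteTopology (StdSphere n) := by
  subst hn
  have : Finite (StdSphere 0) := Set.finite_univ_iff.1 <|
    (Set.toFinite {base 0, -base 0}).subset fun y _ => eq_base_or_neg y
  infer_instance

lemma eq_neg_base {n : ℕ} (hn : n = 0) {y : StdSphere n} (hy : y ≠ base n) : y = -base n := by
  subst hn
  exact (eq_base_or_neg y).resolve_left hy

lemma neg_base_ne (n : ℕ) : -base n ≠ base n := by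
  intro h
  have h : -(base n).1 0 = (base n).1 0 := congrArg (fun y : StdSphere n => y.1 0) h
  rw [base_apply_zero] at h
  norm_num at h

end StdSphere

namespace SphereWedge

variable {ι : Type} (d : ι → ℕ)

open Classical in
/-- Separating the `0`-dimensional spheres of a wedge. -/
noncomputable def separate : C(SphereWedge d,
    SphereWedge (fun i : {i // d i ≠ 0} => d i) ⊕ Σ _ : {i // d i = 0}, Unit) :=
  WedgeSum.lift (.inl (WedgeSum.base _ _))
    -- A 0-sphere is discrete, so sending its base point to the wedge and its other point to a
    -- separate summand is continuous.
    (fun i => if h : d i = 0 then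
        ⟨fun y => if y = StdSphere.base (d i) then .inl (WedgeSum.base _ _) else .inr ⟨⟨i, h⟩, ()⟩,
          by have := StdSphere.discreteTopology h; exact continuous_of_discreteTopology⟩
      else ⟨fun y => .inl (WedgeSum.incl _ (⟨i, h⟩ : {i // d i ≠ 0}) y),
        continuous_inl.comp (WedgeSum.continuous_incl (X := fun i : {i // d i ≠ 0} =>
          StdSphere (d i)) ⟨i, h⟩)⟩)
    fun i => by
      by_cases h : d i = 0
      · simp [h]
      · simp only [h, dite_false, ContinuousMap.coe_mk]
        exact congrArg Sum.inl (WedgeSum.incl_base (p := fun i : {i // d i ≠ 0} =>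
          StdSphere.base (d i)) ⟨i, h⟩)

/-- The inclusion of the spheres of positive dimension in a wedge. -/
noncomputable def ofPositive : C(SphereWedge (fun i : {i // d i ≠ 0} => d i), SphereWedge d) :=
  WedgeSum.lift (WedgeSum.base _ _)
    (fun i => ⟨WedgeSum.incl (fun i => StdSphere.base (d i)) i.1, WedgeSum.continuous_incl _⟩)
    fun i => WedgeSum.incl_base (p := fun i => StdSphere.base (d i)) i.1

/-- Attaching the `0`-dimensional spheres of a wedge. -/
noncomputable def attach : C(SphereWedge (fun i : {i // d i ≠ 0} => d i) ⊕
    Σ _ : {i // d i = 0}, Unit, SphereWedge d) where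
  toFun := Sum.elim (ofPositive d) fun a => WedgeSum.incl (fun i => StdSphere.base (d i)) a.1.1
    (-StdSphere.base _)
  continuous_toFun := (map_continuous _).sumElim
    (continuous_sigma fun _ => continuous_of_discreteTopology)

lemma attach_separate (w : SphereWedge d) : attach d (separate d w) = w := by
  obtain rfl | ⟨i, y, rfl⟩ := w.base_or_incl
  · rfl
  · by_cases h : d i = 0
    · by_cases hy : y = StdSphere.base (d i)
      · subst hy
        rw [WedgeSum.incl_base]
        rfl
      · simp only [separate, WedgeSum.lift_incl, h, dite_true, ContinuousMap.coe_mk, hy, if_false]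
        rw [StdSphere.eq_neg_base h hy]
        rfl
    · simp only [separate, WedgeSum.lift_incl, h, dite_false, ContinuousMap.coe_mk]
      rfl

lemma separate_attach (w) : separate d (attach d w) = w := by
  rcases w with w | ⟨⟨i, h⟩, ⟨⟩⟩
  · obtain rfl | ⟨⟨i, h⟩, y, rfl⟩ := w.base_or_incl
    · rfl
    · change separate d (WedgeSum.incl _ i y) = _
      simp [separate, h]
  · change separate d (WedgeSum.incl _ i (-StdSphere.base _)) = _
    simp [separate, h, StdSphere.neg_base_ne]

/-- A wedge of spheres is the disjoint union of the wedge of its spheres of positive dimension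
with a discrete space. -/
noncomputable def homeomorphSum : SphereWedge d ≃ₜ
    SphereWedge (fun i : {i // d i ≠ 0} => d i) ⊕ Σ _ : {i // d i = 0}, Unit where
  toFun := separate d
  invFun := attach d
  left_inv := attach_separate d
  right_inv := separate_attach d
  continuous_toFun := map_continuous _
  continuous_invFun := map_continuous _

/-- The suspension of a wedge of spheres. -/
noncomputable def suspensionEquiv :
    Suspension (SphereWedge d) ≃ₕ SphereWedge (fun i => d i + 1) :=
  (isSuspension_mk (SphereWedge d)).homotopyEquivWedge
    (fun i => StdSphere.isSuspension_susp (d i)) (fun i => StdSphere.base_eq_susp (d i))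
    StdSphere.arcContraction_zero StdSphere.arcContraction_one StdSphere.arcContraction_mid
    fun i => StdSphere.isSegmentContraction_push (d i)

/-- Induction on a strict bound `n` for the dimensions: the 0-spheres become isolated points, the
rest desuspends once. For `n = 0` there are no spheres and the wedge is a point. -/
lemma isIndependenceComplexType (ι : Type) [Finite ι] (d : ι → ℕ) :
    IsIndependenceComplexType (SphereWedge d) := by
  obtain ⟨n, hn⟩ : ∃ n, ∀ i, d i < n := by
    obtain ⟨n, hn⟩ := (Set.finite_range d).bddAbove
    exact ⟨n + 1, fun i => Nat.lt_succ_of_le (hn ⟨i, rfl⟩)⟩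
  induction n generalizing ι with
  | zero =>
    have : IsEmpty ι := ⟨fun i => (Nat.not_lt_zero _ (hn i)).elim⟩
    let _ : Unique (SphereWedge d) :=
      { default := WedgeSum.base _ _
        uniq := fun w => w.base_or_incl.resolve_right fun ⟨i, _⟩ => isEmptyElim i }
    exact .of_unique
  | succ n ih =>
    refine IsIndependenceComplexType.congr (.sum ?_ (.sigma_unit _))
      (homeomorphSum d).symm.toHomotopyEquiv
    have hd : (fun i : {i // d i ≠ 0} => d i) = fun i : {i // d i ≠ 0} => (d i - 1) + 1 :=
      funext fun i => by have := i.2; omega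
    rw [hd]
    have : Nonempty (SphereWedge fun i : {i // d i ≠ 0} => d i - 1) := ⟨WedgeSum.base _ _⟩
    exact (ih _ _ fun i => by have := i.2; have := hn i; omega).suspension.congr (suspensionEquiv _)

end SphereWedge

/-! ### A circle graph whose independence complex is not a wedge of spheres -/

/-- The exponential map has no continuous section on the circle. -/
lemma Circle.not_exists_section_exp (s : C(Circle, ℝ)) : ¬ ∀ z, Circle.exp (s z) = z := by
  intro hs
  -- `g` compares `s` at antipodal points and changes sign over a half turn. At a zero of `g`, `s`
  -- agrees at antipodal points, which a section cannot do.
  let g : ℝ → ℝ := fun θ => s (Circle.exp θ) - s (Circle.exp (θ + Real.pi))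
  have hg : Continuous g := by fun_prop
  have hπ : g Real.pi = - g 0 := by
    have : Circle.exp (Real.pi + Real.pi) = Circle.exp 0 := by
      rw [← two_mul, Circle.exp_two_pi, Circle.exp_zero]
    simp only [g, this, zero_add]
    ring
  obtain ⟨θ, hθ⟩ : ∃ θ, g θ = 0 := by
    rcases le_total (g 0) 0 with h | h
    · exact mem_range_of_exists_le_of_exists_ge hg ⟨0, h⟩ ⟨Real.pi, by linarith⟩
    · exact mem_range_of_exists_le_of_exists_ge hg ⟨Real.pi, by linarith⟩ ⟨0, h⟩
  have h := hs (Circle.exp θ)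
  rw [sub_eq_zero.1 hθ, hs, Circle.exp_add, mul_eq_left] at h
  have h := congrArg (fun z : Circle => (z : ℂ)) h
  simp only [Circle.coe_exp, Complex.exp_pi_mul_I, Circle.coe_one] at h
  norm_num at h

/-- The circle is not contractible. -/
lemma Circle.not_homotopic_const (z : Circle) :
    ¬ (ContinuousMap.const Circle z).Homotopic (.id Circle) := by
  rintro ⟨H⟩
  obtain ⟨e, rfl⟩ := Circle.exp_surjective z
  have h0 : ∀ a, H.toContinuousMap (0, a) = Circle.exp (ContinuousMap.const Circle e a) :=
    fun a => H.map_zero_left a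
  -- Lifting the homotopy from a constant map through `Circle.exp` gives, at time `1`, a section of
  -- `Circle.exp`.
  let F := Circle.isCoveringMap_exp.liftHomotopy H.toContinuousMap (.const Circle e) h0
  refine Circle.not_exists_section_exp (F.comp ⟨fun z => (1, z), by fun_prop⟩) fun z => ?_
  have := congrFun (Circle.isCoveringMap_exp.liftHomotopy_lifts H.toContinuousMap
    (.const Circle e) h0) (1, z)
  exact this.trans (H.map_one_left z)

namespace StdSphere

/-- The inclusion of `Circle` in the standard `1`-sphere. -/
noncomputable def ofCircle : C(Circle, StdSphere 1) where
  toFun z := ⟨WithLp.toLp 2 ![(z : ℂ).re, (z : ℂ).im], mem_iff.2 (by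
    have := Circle.normSq_coe z
    rw [Complex.normSq_apply] at this
    simp [Fin.sum_univ_two]
    linarith)⟩
  continuous_toFun := continuous_mk _ fun i => by
    fin_cases i
    · exact Complex.continuous_re.comp continuous_subtype_val
    · exact Complex.continuous_im.comp continuous_subtype_val

/-- The projection of the standard `1`-sphere to `Circle`. -/
noncomputable def toCircle : C(StdSphere 1, Circle) where
  toFun y := ⟨⟨y.1 0, y.1 1⟩, mem_sphere_zero_iff_norm.2 (by
    have := sum_sq y
    rw [Fin.sum_univ_two] at this
    rw [Complex.norm_def, Complex.normSq_mk, Real.sqrt_eq_one]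
    linarith)⟩
  continuous_toFun := Continuous.subtype_mk (Complex.equivRealProdCLM.symm.continuous.comp
    ((continuous_coord 0).prodMk (continuous_coord 1))) _

lemma joined {n : ℕ} (hn : n ≠ 0) (x y : StdSphere n) : Joined x y := by
  have h : 1 < Module.rank ℝ (EuclideanSpace ℝ (Fin (n + 1))) := by
    rw [← Module.finrank_eq_rank, finrank_euclideanSpace_fin]
    exact_mod_cast Nat.succ_lt_succ (Nat.pos_of_ne_zero hn)
  have := isPathConnected_iff_pathConnectedSpace.1
    (isPathConnected_sphere h (0 : EuclideanSpace ℝ (Fin (n + 1))) zero_le_one)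
  exact PathConnectedSpace.joined x y

end StdSphere

/-- A map from a connected space to a wedge of spheres is constant, or its values can be joined to
the base point. -/
lemma SphereWedge.eq_const_or_joined {X ι : Type} [TopologicalSpace X] [PreconnectedSpace X]
    {d : ι → ℕ} (f : C(X, SphereWedge d)) (x : X) :
    (∃ w, f = .const X w) ∨ Joined (WedgeSum.base _ _) (f x) := by
  -- `χ` tells which isolated point, if any, is hit. It is continuous into a discrete space, hence
  -- constant on a connected source, even for infinite `ι`.
  let χ : SphereWedge (fun i : {i // d i ≠ 0} => d i) ⊕ (Σ _ : {i // d i = 0}, Unit) →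
    Option {i // d i = 0} := Sum.elim (fun _ => none) fun a => some a.1
  let _ : TopologicalSpace (Option {i // d i = 0}) := ⊥
  have : DiscreteTopology (Option {i // d i = 0}) := ⟨rfl⟩
  have hχ : Continuous χ := continuous_const.sumElim
    (continuous_sigma fun _ => continuous_of_discreteTopology)
  have hconst : ∀ y, χ (separate d (f y)) = χ (separate d (f x)) := fun y =>
    PreconnectedSpace.constant ‹_› (hχ.comp ((separate d).comp f).continuous)
  rcases h : separate d (f x) with w | ⟨a, ⟨⟩⟩
  · right
    rw [← attach_separate d (f x), h]
    obtain rfl | ⟨⟨i, hi⟩, y, rfl⟩ := w.base_or_incl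
    · exact Joined.refl _
    · have := (StdSphere.joined hi (StdSphere.base (d i)) y).map
        (WedgeSum.continuous_incl (p := fun i => StdSphere.base (d i)) i)
      rwa [WedgeSum.incl_base] at this
  · left
    refine ⟨attach d (.inr ⟨a, ()⟩), ContinuousMap.ext fun y => ?_⟩
    have hy := hconst y
    rw [h] at hy
    rw [← attach_separate d (f y)]
    rcases h' : separate d (f y) with w | ⟨b, ⟨⟩⟩ <;> rw [h'] at hy
    · exact absurd hy (by simp [χ])
    · obtain rfl : b = a := by simpa [χ] using hy
      rfl

lemma ContinuousMap.Homotopic.joined {X Y : Type*} [TopologicalSpace X] [TopologicalSpace Y]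
    {f g : C(X, Y)} (h : f.Homotopic g) (x : X) : Joined (f x) (g x) := by
  obtain ⟨H⟩ := h
  exact ⟨H.evalAt x⟩

/-- A disjoint union of two circles is not homotopy equivalent to a wedge of spheres. -/
lemma isEmpty_homotopyEquiv_sphereWedge {ι : Type} (d : ι → ℕ) :
    IsEmpty ((Σ _ : Fin 2, SphereWedge fun _ : Fin 1 => 1) ≃ₕ SphereWedge d) := by
  refine ⟨fun e => ?_⟩
  let j : Fin 2 → C(Circle, Σ _ : Fin 2, SphereWedge fun _ : Fin 1 => 1) := fun i =>
    ⟨fun z => ⟨i, WedgeSum.incl _ 0 (StdSphere.ofCircle z)⟩,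
      continuous_sigmaMk.comp ((WedgeSum.continuous_incl _).comp (map_continuous _))⟩
  -- `ρ` folds both circles onto one, so `ρ ∘ j i` is the identity; if `e ∘ j i` were constant, the
  -- circle would be contractible.
  let ρ : C(Σ _ : Fin 2, SphereWedge fun _ : Fin 1 => 1, Circle) :=
    ⟨fun a => WedgeSum.lift (StdSphere.toCircle (StdSphere.base 1))
      (fun _ => StdSphere.toCircle) (fun _ => rfl) a.2,
      continuous_sigma fun _ => map_continuous (WedgeSum.lift _ _ _)⟩
  have : PreconnectedSpace Circle := ⟨by
    rw [← Circle.exp_surjective.range_eq]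
    exact isPreconnected_range Circle.exp.continuous⟩
  have hbase : ∀ i, Joined (WedgeSum.base _ _) (e (j i 1)) := by
    intro i
    refine (SphereWedge.eq_const_or_joined (e.toFun.comp (j i)) 1).resolve_left ?_
    rintro ⟨w, hw⟩
    apply Circle.not_homotopic_const (ρ (e.symm w))
    have h : ((ρ.comp (e.invFun.comp e.toFun)).comp (j i)).Homotopic
        ((ρ.comp (.id _)).comp (j i)) :=
      .comp (.comp (.refl _) e.left_inv) (.refl _)
    have h1 : (ρ.comp (e.invFun.comp e.toFun)).comp (j i) = .const _ (ρ (e.symm w)) :=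
      ContinuousMap.ext fun z =>
        congrArg (fun w => ρ (e.symm w)) (ContinuousMap.congr_fun hw z)
    rwa [h1] at h
  have h01 : Joined (j 0 1) (j 1 1) :=
    ((e.left_inv.joined (j 0 1)).symm.trans
      (((hbase 0).symm.trans (hbase 1)).map e.symm.continuous)).trans (e.left_inv.joined (j 1 1))
  obtain ⟨γ⟩ := h01
  -- The index is locally constant, so no path joins the two circles.
  have hfst : Continuous (Sigma.fst : (Σ _ : Fin 2, SphereWedge fun _ : Fin 1 => 1) → Fin 2) :=
    continuous_sigma fun _ => continuous_const
  have := PreconnectedSpace.constant (inferInstance : PreconnectedSpace I)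
    (hfst.comp γ.continuous) (x := 0) (y := 1)
  simp [j] at this

theorem mainTheorem2 :
    (∀ (k : ℕ) (m : Fin k → ℕ) (d : ∀ i : Fin k, Fin (m i) → ℕ),
      ∃ (V : Type) (_ : Fintype V) (G : SimpleGraph V), G.IsCircleGraph ∧
        Nonempty (G.independenceComplex.realization ≃ₕ (Σ i : Fin k, SphereWedge (d i)))) ∧
    (∃ (V : Type) (_ : Fintype V) (G : SimpleGraph V), Nonempty V ∧ G.IsCircleGraph ∧
      ∀ (ι : Type) (d : ι → ℕ),
        IsEmpty (G.independenceComplex.realization ≃ₕ SphereWedge d)) := by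
  constructor
  · intro k m d
    obtain ⟨V, hV, G, hG, he⟩ := IsIndependenceComplexType.sigma_fin fun i =>
      SphereWedge.isIndependenceComplexType (Fin (m i)) (d i)
    exact ⟨V, hV, G, hG.isCircleGraph, he⟩
  · obtain ⟨V, hV, G, hG, ⟨e⟩⟩ := IsIndependenceComplexType.sigma_fin fun _ : Fin 2 =>
      SphereWedge.isIndependenceComplexType (Fin 1) fun _ => 1
    obtain ⟨v, -⟩ := SimpleGraph.exists_ne_zero_of_mem_realization
      (e.symm ⟨0, WedgeSum.base _ _⟩)
    exact ⟨V, hV, G, ⟨v⟩, hG.isCircleGraph, fun ι d =>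
      ⟨fun f => (isEmpty_homotopyEquiv_sphereWedge d).false (e.symm.trans f)⟩⟩
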